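/- **Model.** A typical user is at the origin of $\mathbb R^2$. The horizontal positions of the aerial base stations (ABSs), all at height $h>0$, form a homogeneous Poisson point process of density $\lambda_A>0$; the terrestrial base stations (TBSs) form an independent homogeneous Poisson point process of density $\lambda_T>0$ on the ground plane. Given the positions, the link of an ABS at horizontal distance $x$ is, independently of everything else, line-of-sight (LoS) with probability $P_L(x)$ and NLoS with probability $P_N(x)=1-P_L(x)$, where $P_L:[0,\infty)\to[0,1]$ is measurable (for example an S-curve $1/(1+ae^{-b\theta(x)})$ with $a\ge 0$ and $\theta$ measurable). The fading gains $H$ of the ABSs are independent of each other and of the rest of the model, with law Gamma$(m_L,1/m_L)$ (shape, scale) on LoS links and Gamma$(m_N,1/m_N)$ on NLoS links. An ABS at distance $R=\sqrt{x^2+h^2}$ from the user gives average received power $\eta_LR^{-\alpha_L}$ (LoS) or $\eta_NR^{-\alpha_N}$ (NLoS), where $\eta_L=a_nP_AC_L$ and $\eta_N=a_nP_AC_N$; a TBS at distance $\rho$ gives $\eta_T\rho^{-\alpha_T}$ if $\rho\le R_B$ and $0$ otherwise, where $\eta_T=G_MP_TC_T$. All of $h,R_B,P_A,P_T,G_M,a_n,C_\bullet,\alpha_\bullet,m_\bullet$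 are positive. The user is associated with the base station of maximum average received power. Let $B_N$ (resp. $B_L$) be the event that this is a NLoS (resp. LoS) ABS, and let $r$ denote the distance to it, which is the distance $R_{N,0}$ (resp. $R_{L,0}$) to the nearest NLoS (resp. LoS) ABS. The interference from the ABSs is $I_A=I_L+I_N\in[0,\infty]$, where $I_L=\sum P_AC_LR^{-\alpha_L}H$ and $I_N=\sum P_AC_NR^{-\alpha_N}H$ are sums over all LoS, respectively NLoS, ABSs except the serving one. Put $$\tau_{L|N}(r)=\Big(\frac{\eta_L}{\eta_N}\Big)^{1/\alpha_L}r^{\alpha_N/\alpha_L},\quad l_{L,h}=\tau_{L|N}(h),\quad \tau_{N|L}(r)=\begin{cases}h,& r\le l_{L,h},\\ (\eta_N/\eta_L)^{1/\alpha_N}r^{\alpha_L/\alpha_N},& r>l_{L,h},\end{cases}$$ and $w(d)=\sqrt{\max(d^2-h^2,0)}$. **Lemma.** Let $s\ge 0$ and $e^{-\infty}=0$. Conditionally on $B_N$ and on $R_{N,0}=r$, respectively on $B_L$ and on $R_{L,0}=r$, for almost every $r$ with respect to the conditional law of the serving distance, $$L_{I_A}(s)=\mathbb E\big[e^{-sI_A}\,\big|\,\cdot\,\big]=L_{I_L}(s)\,L_{I_N}(s),$$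 $$L_{I_L}(s)=\mathbb E\big[e^{-sI_L}\,\big|\,\cdot\,\big]=\exp\Big(-2\pi\lambda_A\int_{w_L}^{\infty}\Big(1-\Big(1+\frac{sP_AC_L}{m_L(x^2+h^2)^{\alpha_L/2}}\Big)^{-m_L}\Big)P_L(x)\,x\,dx\Big),$$ $$L_{I_N}(s)=\mathbb E\big[e^{-sI_N}\,\big|\,\cdot\,\big]=\exp\Big(-2\pi\lambda_A\int_{w_N}^{\infty}\Big(1-\Big(1+\frac{sP_AC_N}{m_N(x^2+h^2)^{\alpha_N/2}}\Big)^{-m_N}\Big)P_N(x)\,x\,dx\Big),$$ where $w_L=w(\tau_{L|N}(r))$ and $w_N=w(r)$ under $B_N$, while $w_L=w(r)$ and $w_N=w(\tau_{N|L}(r))$ under $B_L$. The same formulas hold if one conditions in addition on the existence, or on the non-existence, of a TBS within distance $R_B$ of the user. -/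

import Mathlib

namespace UAVNet

open MeasureTheory ProbabilityTheory
open scoped ENNReal NNReal

/-- The ground plane with its Euclidean norm; the typical user (UE) sits at the origin. -/
abbrev Plane : Type := EuclideanSpace ℝ (Fin 2)

/-- The S-curve shape `x ↦ 1 / (1 + a exp (-b θ(x)))`; in the standard air-to-ground model `θ(x)` is
the elevation angle (in degrees) of a base station at horizontal distance `x`, shifted by `a`. -/
noncomputable def sCurve (a b : ℝ) (θ : ℝ → ℝ) (x : ℝ) : ℝ :=
  1 / (1 + a * Real.exp (-b * θ x))

/-- Every S-curve is an admissible line-of-sight probability in the sense of `Params`. -/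
theorem sCurve_admissible {a : ℝ} (ha : 0 ≤ a) (b : ℝ) {θ : ℝ → ℝ} (hθ : Measurable θ) :
    Measurable (sCurve a b θ) ∧ ∀ x, sCurve a b θ x ∈ Set.Icc (0 : ℝ) 1 := by
  refine ⟨?_, fun x => ?_⟩
  · unfold sCurve
    fun_prop
  · have h : 0 ≤ a * Real.exp (-b * θ x) := mul_nonneg ha (Real.exp_pos _).le
    refine ⟨by unfold sCurve; positivity, ?_⟩
    unfold sCurve
    rw [div_le_one (by linarith)]
    linarith

/-- Deterministic parameters of the two-tier network. The line-of-sight probability `PL`, a function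
of the horizontal distance, may be any measurable function into `[0, 1]`. -/
structure Params where
  /-- density of the aerial base stations (ABSs) -/
  lamA : ℝ
  /-- density of the terrestrial base stations (TBSs) -/
  lamT : ℝ
  /-- height of the ABSs -/
  h : ℝ
  /-- line-of-sight radius of the terrestrial tier -/
  RB : ℝ
  /-- transmit power of an ABS -/
  PA : ℝ
  /-- transmit power of a TBS -/
  PT : ℝ
  /-- main-lobe gain of a TBS -/
  GM : ℝ
  /-- NOMA power allocation factor of the near user -/
  an : ℝ
  /-- additive losses -/
  CL : ℝ
  CN : ℝ
  CT : ℝ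
  /-- path loss exponents -/
  alphaL : ℝ
  alphaN : ℝ
  alphaT : ℝ
  /-- Nakagami fading parameters of the air-to-ground links -/
  mL : ℝ
  mN : ℝ
  /-- probability that an ABS at horizontal distance `x` has a line-of-sight link -/
  PL : ℝ → ℝ
  lamA_pos : 0 < lamA
  lamT_pos : 0 < lamT
  h_pos : 0 < h
  RB_pos : 0 < RB
  PA_pos : 0 < PA
  PT_pos : 0 < PT
  GM_pos : 0 < GM
  an_pos : 0 < an
  CL_pos : 0 < CL
  CN_pos : 0 < CN
  CT_pos : 0 < CT
  alphaL_pos : 0 < alphaL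
  alphaN_pos : 0 < alphaN
  alphaT_pos : 0 < alphaT
  mL_pos : 0 < mL
  mN_pos : 0 < mN
  PL_measurable : Measurable PL
  PL_mem : ∀ x, 0 ≤ x → PL x ∈ Set.Icc (0 : ℝ) 1

namespace Params

variable (p : Params)

/-- Probability of a non-line-of-sight link at horizontal distance `x`. -/
def PN (x : ℝ) : ℝ := 1 - p.PL x

noncomputable def etaL : ℝ := p.an * p.PA * p.CL
noncomputable def etaN : ℝ := p.an * p.PA * p.CN
noncomputable def etaT : ℝ := p.GM * p.PT * p.CT

/-- `l_{L,h}`: distance at which a LoS ABS has the same average received power as a NLoS ABS at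
distance `h`. -/
noncomputable def lLh : ℝ :=
  (p.etaL / p.etaN) ^ (1 / p.alphaL) * p.h ^ (p.alphaN / p.alphaL)

/-- `τ_{L|N}(r)`: minimum distance of the interfering LoS ABSs if the UE is served by a NLoS ABS at
distance `r`. -/
noncomputable def tauLN (r : ℝ) : ℝ :=
  (p.etaL / p.etaN) ^ (1 / p.alphaL) * r ^ (p.alphaN / p.alphaL)

/-- `τ_{N|L}(r)`: minimum distance of the interfering NLoS ABSs if the UE is served by a LoS ABS at
distance `r`. -/
noncomputable def tauNL (r : ℝ) : ℝ :=
  if r ≤ p.lLh then p.h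
  else (p.etaN / p.etaL) ^ (1 / p.alphaN) * r ^ (p.alphaL / p.alphaN)

/-- Horizontal distance belonging to the distance `d`; it is `0` if `d < h`, since `Real.sqrt`
vanishes on negative numbers. -/
noncomputable def horiz (d : ℝ) : ℝ := Real.sqrt (d ^ 2 - p.h ^ 2)

end Params

/-- `exp (-t)` for `t ∈ [0, ∞]`, with `exp (-∞) = 0`. -/
noncomputable def expNeg (t : ℝ≥0∞) : ℝ := if t = ∞ then 0 else Real.exp (-t.toReal)

/-- `exp (-2πλ ∫_w^∞ (1 - (1 + s P C / (m (x² + h²)^(α/2)))^(-m)) q(x) x dx)`; the integrand is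
nonnegative, and the integral is allowed to be infinite. -/
noncomputable def laplaceFactor (lam P h C alpha m : ℝ) (q : ℝ → ℝ) (s w : ℝ) : ℝ :=
  expNeg (ENNReal.ofReal (2 * Real.pi * lam) *
    ∫⁻ x in Set.Ioi w, ENNReal.ofReal
      ((1 - (1 + s * P * C / (m * (x ^ 2 + h ^ 2) ^ (alpha / 2))) ^ (-m)) * q x * x))

namespace Params

variable (p : Params)

/-- The LoS factor, with lower integration limit `w`. -/
noncomputable def factorL (s w : ℝ) : ℝ :=
  laplaceFactor p.lamA p.PA p.h p.CL p.alphaL p.mL p.PL s w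

/-- The NLoS factor, with lower integration limit `w`. -/
noncomputable def factorN (s w : ℝ) : ℝ :=
  laplaceFactor p.lamA p.PA p.h p.CN p.alphaN p.mN p.PN s w

end Params

/-- Number of points of the sequence `X` lying in `B`. -/
noncomputable def count {Ω : Type*} (X : ℕ → Ω → Plane) (B : Set Plane) (ω : Ω) : ℕ∞ :=
  {n | X n ω ∈ B}.encard

/-- The points `X 0, X 1, …` (enumerated in any measurable way) form a homogeneous Poisson point
process of density `lam` on the plane. -/
structure IsHPPP {Ω : Type*} [MeasurableSpace Ω] (μ : Measure Ω) (lam : ℝ)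
    (X : ℕ → Ω → Plane) : Prop where
  measurable : ∀ n, Measurable (X n)
  poisson : ∀ B : Set Plane, MeasurableSet B → volume B ≠ ∞ → ∀ k : ℕ,
    μ {ω | count X B ω = k} = poissonMeasure (lam.toNNReal * (volume B).toNNReal) {k}
  indep : ∀ (N : ℕ) (B : Fin N → Set Plane), (∀ i, MeasurableSet (B i)) →
    Pairwise (Function.onFun Disjoint B) → iIndepFun (fun i => count X (B i)) μ

/-- The random elements of the network. -/
structure Network (Ω : Type*) where
  /-- horizontal positions of the ABSs -/
  X : ℕ → Ω → Plane
  /-- positions of the TBSs -/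
  Y : ℕ → Ω → Plane
  /-- uniform variables deciding the link states: ABS `n` is LoS iff `U n ≤ P_L(‖X n‖)` -/
  U : ℕ → Ω → ℝ
  /-- small-scale fading gain of ABS `n` if its link is LoS -/
  HL : ℕ → Ω → ℝ
  /-- small-scale fading gain of ABS `n` if its link is NLoS -/
  HN : ℕ → Ω → ℝ

namespace Network

variable {Ω : Type*} (net : Network Ω) (p : Params)

/-- The link between the typical UE and ABS `n` is line-of-sight. -/
def LoS (n : ℕ) (ω : Ω) : Prop := net.U n ω ≤ p.PL ‖net.X n ω‖

/-- Distance between the typical UE and ABS `n`. -/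
noncomputable def R (n : ℕ) (ω : Ω) : ℝ := Real.sqrt (‖net.X n ω‖ ^ 2 + p.h ^ 2)

open Classical in
/-- Average power received from ABS `n`. -/
noncomputable def powA (n : ℕ) (ω : Ω) : ℝ :=
  if net.LoS p n ω then p.etaL * net.R p n ω ^ (-p.alphaL)
  else p.etaN * net.R p n ω ^ (-p.alphaN)

open Classical in
/-- Average power received from TBS `k`, zero outside the LoS ball. -/
noncomputable def powT (k : ℕ) (ω : Ω) : ℝ :=
  if ‖net.Y k ω‖ ≤ p.RB then p.etaT * ‖net.Y k ω‖ ^ (-p.alphaT) else 0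

/-- The typical UE is associated with ABS `n`: it provides the maximum average received power among
all base stations of both tiers. -/
def Serving (n : ℕ) (ω : Ω) : Prop :=
  (∀ k, net.powA p k ω ≤ net.powA p n ω) ∧ ∀ k, net.powT p k ω ≤ net.powA p n ω

/-- The event that the typical UE is associated with a NLoS ABS. -/
def eventN : Set Ω := {ω | ∃ n, ¬ net.LoS p n ω ∧ net.Serving p n ω}

/-- The event that the typical UE is associated with a LoS ABS. -/
def eventL : Set Ω := {ω | ∃ n, net.LoS p n ω ∧ net.Serving p n ω}

/-- The event that there is a TBS in the LoS ball. -/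
def tbsInBall : Set Ω := {ω | ∃ k, ‖net.Y k ω‖ ≤ p.RB}

/-- Distance between the typical UE and the nearest LoS ABS. -/
noncomputable def RL0 (ω : Ω) : ℝ := sInf {r | ∃ n, net.LoS p n ω ∧ r = net.R p n ω}

/-- Distance between the typical UE and the nearest NLoS ABS. -/
noncomputable def RN0 (ω : Ω) : ℝ := sInf {r | ∃ n, ¬ net.LoS p n ω ∧ r = net.R p n ω}

open Classical in
/-- Interference from the LoS ABSs, the serving ABS excluded. -/
noncomputable def interfL (ω : Ω) : ℝ≥0∞ :=
  ∑' n, if net.LoS p n ω ∧ ¬ net.Serving p n ω then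
    ENNReal.ofReal (p.PA * p.CL * net.R p n ω ^ (-p.alphaL) * net.HL n ω) else 0

open Classical in
/-- Interference from the NLoS ABSs, the serving ABS excluded. -/
noncomputable def interfN (ω : Ω) : ℝ≥0∞ :=
  ∑' n, if ¬ net.LoS p n ω ∧ ¬ net.Serving p n ω then
    ENNReal.ofReal (p.PA * p.CN * net.R p n ω ^ (-p.alphaN) * net.HN n ω) else 0

/-- Interference from all ABSs. -/
noncomputable def interfA (ω : Ω) : ℝ≥0∞ := net.interfL p ω + net.interfN p ω

/-- The probabilistic model: both tiers are homogeneous Poisson point processes, the link states are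
independent given the positions, the fading gains are Gamma distributed with shape `m` and scale
`1 / m`, and everything is independent. -/
structure IsModel [MeasurableSpace Ω] (μ : Measure Ω) : Prop where
  hppp_X : IsHPPP μ p.lamA net.X
  hppp_Y : IsHPPP μ p.lamT net.Y
  measurable_U : ∀ n, Measurable (net.U n)
  measurable_HL : ∀ n, Measurable (net.HL n)
  measurable_HN : ∀ n, Measurable (net.HN n)
  law_U : ∀ n, μ.map (net.U n) = volume.restrict (Set.Icc 0 1)
  law_HL : ∀ n, μ.map (net.HL n) = gammaMeasure p.mL p.mL
  law_HN : ∀ n, μ.map (net.HN n) = gammaMeasure p.mN p.mN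
  /-- all the variables `U n`, `HL n`, `HN n` are independent -/
  indep_marks : iIndepFun (Sum.elim net.U (Sum.elim net.HL net.HN)) μ
  /-- the TBSs are independent of these variables … -/
  indep_Y : IndepFun (fun ω n => net.Y n ω)
    (fun ω => (fun n => net.U n ω, fun n => net.HL n ω, fun n => net.HN n ω)) μ
  /-- … and the ABS positions are independent of all the rest -/
  indep_X : IndepFun (fun ω n => net.X n ω)
    (fun ω => (fun n => net.Y n ω, fun n => net.U n ω, fun n => net.HL n ω,
      fun n => net.HN n ω)) μ

end Network

/-- Laplace transform at `s` of the interference `I` conditionally on the event `B` and on the value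
of the distance `R`: the conditional expectation of `exp (-s I)` given `R` under `μ( · | B)`. -/
noncomputable def condLaplace {Ω : Type*} [MeasurableSpace Ω] (μ : Measure Ω) (B : Set Ω)
    (R : Ω → ℝ) (I : Ω → ℝ≥0∞) (s : ℝ) : Ω → ℝ :=
  condExp (MeasurableSpace.comap R inferInstance) (cond μ B)
    (fun ω => expNeg (ENNReal.ofReal s * I ω))

end UAVNet

namespace UAVNet

open MeasureTheory ProbabilityTheory
open scoped ENNReal NNReal
open Filter Topology

/-! Attach to each ABS its uniform link variable and both candidate fading gains. Independent
marking makes the marked ABSs Poisson with a product intensity (`IsHPPP.marking`); all that is used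
of this is the Laplace functional, recorded in `HasPoissonLaplace`. The score of a marked point is
the inverse of its average received power. An ABS serves exactly when its score is minimal and no
TBS beats that minimum, so the TBSs see the ABSs only through the minimal score (`serving_iff`).

The core is `setLIntegral_minIn`: given that the point of minimal score lies in a class `C`, and
given the minimum `v`, the remaining points are Poisson on the set of scores above `v`. If the
minimum is only known to lie in a cell `[a, b)` and no point outside `C` scores below `b`, the event
is a difference of two void events inside the region below `b`, hence independent of the points at
or above `b`. Shrinking the cells gives the claim, because almost surely scores are locally finite
(`ae_finite_score`) and without ties (`ae_injective`).

The TBSs are independent of the marked ABSs; integrating them out leaves a weight depending on the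
minimal score alone (`setLIntegral_minIn_dominated`). This is why conditioning on the presence or
absence of a TBS changes nothing. On the association event the serving distance is a function of the
minimal score, so conditioning on either is the same.

It remains to compute the intensity integral above `v` (`eexpNeg_intensity`): the uniform mark
splits it into a `PL` and a `PN` part, the Gamma marks give the powers `(1 + t / m) ^ (-m)`, and
polar coordinates give the radial integrals. The exponential of the sum of the two parts is the
product formula. Weighting LoS and NLoS links by separate parameters `sL`, `sN` covers the total and
both partial interferences at once, since a factor with parameter `0` equals `1`. -/

/-! ### The function `exp (-t)` on `[0, ∞]` -/

/-- The `[0, ∞]`-valued version of `expNeg`. -/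
noncomputable def eexpNeg (t : ℝ≥0∞) : ℝ≥0∞ := (EReal.exp t)⁻¹

theorem eexpNeg_ofReal {t : ℝ} (ht : 0 ≤ t) :
    eexpNeg (ENNReal.ofReal t) = ENNReal.ofReal (Real.exp (-t)) := by
  rw [eexpNeg, EReal.coe_ennreal_ofReal, max_eq_left ht, EReal.exp_coe,
    ← ENNReal.ofReal_inv_of_pos (Real.exp_pos _), Real.exp_neg]

@[simp] theorem eexpNeg_top : eexpNeg ∞ = 0 := by simp [eexpNeg]

@[simp] theorem eexpNeg_zero : eexpNeg 0 = 1 := by simp [eexpNeg]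

theorem ofReal_expNeg (t : ℝ≥0∞) : ENNReal.ofReal (expNeg t) = eexpNeg t := by
  by_cases h : t = ∞
  · simp [h, expNeg]
  · conv_rhs => rw [← ENNReal.ofReal_toReal h]
    rw [eexpNeg_ofReal ENNReal.toReal_nonneg]
    simp [expNeg, h]

theorem expNeg_nonneg (t : ℝ≥0∞) : 0 ≤ expNeg t := by
  unfold expNeg; split_ifs <;> positivity

theorem toReal_eexpNeg (t : ℝ≥0∞) : (eexpNeg t).toReal = expNeg t := by
  rw [← ofReal_expNeg, ENNReal.toReal_ofReal (expNeg_nonneg t)]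

theorem eexpNeg_add (a b : ℝ≥0∞) : eexpNeg (a + b) = eexpNeg a * eexpNeg b := by
  rw [← ofReal_expNeg, ← ofReal_expNeg, ← ofReal_expNeg, ← ENNReal.ofReal_mul (expNeg_nonneg _)]
  congr 1
  by_cases ha : a = ∞
  · simp [expNeg, ha]
  by_cases hb : b = ∞
  · simp [expNeg, hb]
  simp [expNeg, ha, hb, ENNReal.toReal_add, ← Real.exp_add, add_comm]

theorem eexpNeg_antitone : Antitone eexpNeg := fun a b h => by
  unfold eexpNeg
  rw [ENNReal.inv_le_inv]
  exact EReal.exp_monotone (by exact_mod_cast h)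

theorem eexpNeg_le_one (t : ℝ≥0∞) : eexpNeg t ≤ 1 := by
  simpa using eexpNeg_antitone (bot_le : ⊥ ≤ t)

theorem expNeg_le_one (t : ℝ≥0∞) : expNeg t ≤ 1 := by
  rw [← toReal_eexpNeg]
  exact ENNReal.toReal_mono ENNReal.one_ne_top (eexpNeg_le_one t)

theorem expNeg_antitone : Antitone expNeg := fun a b h => by
  rw [← toReal_eexpNeg, ← toReal_eexpNeg]
  exact ENNReal.toReal_mono (ne_top_of_le_ne_top ENNReal.one_ne_top (eexpNeg_le_one _))
    (eexpNeg_antitone h)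

theorem eexpNeg_ne_top (t : ℝ≥0∞) : eexpNeg t ≠ ∞ :=
  ne_top_of_le_ne_top ENNReal.one_ne_top (eexpNeg_le_one t)

theorem continuous_eexpNeg : Continuous eexpNeg :=
  continuous_inv.comp (ENNReal.continuous_exp.comp continuous_coe_ennreal_ereal)

@[fun_prop]
theorem measurable_eexpNeg : Measurable eexpNeg := continuous_eexpNeg.measurable

theorem measurable_expNeg : Measurable expNeg := by
  have : expNeg = fun t => (eexpNeg t).toReal := funext fun t => (toReal_eexpNeg t).symm
  rw [this]; fun_prop

theorem eexpNeg_sum {ι : Type*} (s : Finset ι) (f : ι → ℝ≥0∞) :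
    eexpNeg (∑ i ∈ s, f i) = ∏ i ∈ s, eexpNeg (f i) := by
  classical
  induction s using Finset.induction_on with
  | empty => simp
  | insert a s ha ih => rw [Finset.sum_insert ha, Finset.prod_insert ha, eexpNeg_add, ih]

theorem tendsto_prod_eexpNeg (f : ℕ → ℝ≥0∞) :
    Tendsto (fun N => ∏ i ∈ Finset.range N, eexpNeg (f i)) atTop (𝓝 (eexpNeg (∑' n, f n))) := by
  simp_rw [← eexpNeg_sum]
  exact (continuous_eexpNeg.tendsto _).comp (ENNReal.tendsto_nat_tsum f)

/-- A measurable logarithm on `[0, 1]`. In `IsHPPP.marking` it turns the factor obtained by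
averaging over a mark back into an exponential, so that the Laplace functional of the positions
applies. -/
theorem exists_eexpNeg_eq : ∃ ψ : ℝ≥0∞ → ℝ≥0∞, Measurable ψ ∧ ∀ t ≤ 1, eexpNeg (ψ t) = t := by
  refine ⟨fun t => if t = 0 then ∞ else ENNReal.ofReal (-Real.log t.toReal), ?_, fun t ht => ?_⟩
  · exact Measurable.ite (measurableSet_singleton 0) measurable_const (by fun_prop)
  · by_cases h : t = 0
    · simp [h]
    · have ht' : t ≠ ∞ := ne_top_of_le_ne_top ENNReal.one_ne_top ht
      have hpos := ENNReal.toReal_pos h ht'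
      have h1 : t.toReal ≤ 1 := by simpa using ENNReal.toReal_mono ENNReal.one_ne_top ht
      simp only [if_neg h]
      rw [eexpNeg_ofReal (by simpa using Real.log_nonpos hpos.le h1), neg_neg,
        Real.exp_log hpos, ENNReal.ofReal_toReal ht']

theorem eexpNeg_mul_natCast (c : ℝ≥0∞) (k : ℕ) : eexpNeg (c * k) = eexpNeg c ^ k := by
  have := eexpNeg_sum (Finset.range k) (fun _ => c)
  simpa [mul_comm] using this

/-! ### Counting variables of a Poisson process -/

theorem lintegral_eexpNeg_poisson (c : ℝ≥0∞) (r : ℝ≥0) :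
    ∫⁻ k, eexpNeg (c * (k : ℝ≥0∞)) ∂(poissonMeasure r) = eexpNeg (r * (1 - eexpNeg c)) := by
  rw [lintegral_countable']
  obtain ⟨z, hz0, hz1, hz⟩ : ∃ z : ℝ, 0 ≤ z ∧ z ≤ 1 ∧ eexpNeg c = ENNReal.ofReal z :=
    ⟨expNeg c, expNeg_nonneg c, expNeg_le_one c, (ofReal_expNeg c).symm⟩
  -- Exponential tilting: `z ^ k` times the Poisson mass of mean `r` is `exp (-r (1 - z))` times the
  -- Poisson mass of mean `r z`, and the latter masses sum to `1`.
  have h := (hasSum_one_poissonMeasure (r * ⟨z, hz0⟩)).mul_left (Real.exp (-(r * (1 - z))))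
  have h2 : ∀ k : ℕ, eexpNeg (c * (k : ℝ≥0∞)) * poissonMeasure r {k} =
      ENNReal.ofReal (Real.exp (-(r * (1 - z))) *
        (Real.exp (-((r * ⟨z, hz0⟩ : ℝ≥0) : ℝ)) * ((r * ⟨z, hz0⟩ : ℝ≥0) : ℝ) ^ k /
          (k.factorial : ℝ))) := by
    intro k
    rw [eexpNeg_mul_natCast, hz, poissonMeasure_singleton, ← ENNReal.ofReal_pow hz0,
      ← ENNReal.ofReal_mul (by positivity)]
    congr 1
    have : Real.exp (-(r : ℝ)) = Real.exp (-(r * (1 - z))) * Real.exp (-(r * z)) := by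
      rw [← Real.exp_add]; congr 1; ring
    rw [this]
    change _ = _ * (Real.exp (-(r * z)) * (r * z) ^ k / _)
    ring
  simp_rw [h2]
  rw [← ENNReal.ofReal_tsum_of_nonneg (fun k => by positivity) h.summable, h.tsum_eq, mul_one, hz]
  rw [← ENNReal.ofReal_one, ← ENNReal.ofReal_sub _ hz0, ← ENNReal.ofReal_coe_nnreal,
    ← ENNReal.ofReal_mul (by positivity), eexpNeg_ofReal]
  exact mul_nonneg r.2 (by linarith)

section HPPP

variable {Ω : Type*} [MeasurableSpace Ω] {μ : Measure Ω} {lam : ℝ} {X : ℕ → Ω → Plane}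

theorem measurable_count (hX : ∀ n, Measurable (X n)) {B : Set Plane} (hB : MeasurableSet B) :
    Measurable (count X B) :=
  measurable_encard.comp (measurable_set_iff.2 fun n =>
    measurable_to_prop (by
      convert hX n hB using 1
      ext; simp))

theorem tsum_indicator_eq_count {Ω : Type*} (X : ℕ → Ω → Plane) (B : Set Plane) (ω : Ω) (c : ℝ≥0∞) :
    ∑' n, B.indicator (fun _ => c) (X n ω) = c * (count X B ω : ℝ≥0∞) := by
  rw [mul_comm, count, ← ENNReal.tsum_set_const, tsum_subtype {n | X n ω ∈ B} (fun _ => c)]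
  rfl

/-- `IsHPPP` prescribes the masses of finite counts only. Both laws have total mass `1` and agree on
these, which forces the mass at `⊤` as well. -/
theorem IsHPPP.map_count [IsProbabilityMeasure μ] (hX : IsHPPP μ lam X) {B : Set Plane}
    (hB : MeasurableSet B) (hB' : volume B ≠ ∞) :
    μ.map (count X B) =
      (poissonMeasure (lam.toNNReal * (volume B).toNNReal)).map (Nat.cast : ℕ → ℕ∞) := by
  have hc := measurable_count hX.measurable hB
  have hn : Measurable (Nat.cast : ℕ → ℕ∞) := .of_discrete
  have : IsProbabilityMeasure (μ.map (count X B)) := Measure.isProbabilityMeasure_map hc.aemeasurable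
  have : IsProbabilityMeasure ((poissonMeasure (lam.toNNReal * (volume B).toNNReal)).map
    (Nat.cast : ℕ → ℕ∞)) := Measure.isProbabilityMeasure_map hn.aemeasurable
  have key : ∀ k : ℕ, μ.map (count X B) {(k : ℕ∞)} =
      (poissonMeasure (lam.toNNReal * (volume B).toNNReal)).map (Nat.cast : ℕ → ℕ∞) {(k : ℕ∞)} := by
    intro k
    rw [Measure.map_apply hc (measurableSet_singleton _),
      Measure.map_apply hn (measurableSet_singleton _)]
    have : (Nat.cast : ℕ → ℕ∞) ⁻¹' {(k : ℕ∞)} = {k} := by ext; simp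
    rw [this, ← hX.poisson B hB hB' k]
    rfl
  refine Measure.ext_of_singleton fun a => ?_
  induction a with
  | coe k => exact key k
  | top =>
    have htop : ({⊤} : Set ℕ∞) = (⋃ k : ℕ, {(k : ℕ∞)})ᶜ := by
      ext a
      induction a <;> simp
    have hm : MeasurableSet (⋃ k : ℕ, {(k : ℕ∞)}) := .of_discrete
    rw [htop, prob_compl_eq_one_sub hm, prob_compl_eq_one_sub hm]
    have hd : Pairwise (Function.onFun Disjoint fun k : ℕ => ({(k : ℕ∞)} : Set ℕ∞)) := by
      intro i j hij
      simpa [Function.onFun] using hij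
    rw [measure_iUnion hd (fun _ => measurableSet_singleton _),
      measure_iUnion hd (fun _ => measurableSet_singleton _)]
    simp_rw [key]

theorem IsHPPP.ae_finite [IsProbabilityMeasure μ] (hX : IsHPPP μ lam X) {B : Set Plane}
    (hB : MeasurableSet B) (hB' : volume B ≠ ∞) : ∀ᵐ ω ∂μ, {n | X n ω ∈ B}.Finite := by
  have hc := measurable_count hX.measurable hB
  have hn : Measurable (Nat.cast : ℕ → ℕ∞) := .of_discrete
  have : ∀ᵐ a ∂(μ.map (count X B)), a ≠ ⊤ := by
    rw [hX.map_count hB hB', ae_map_iff hn.aemeasurable .of_discrete]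
    simp
  filter_upwards [ae_of_ae_map hc.aemeasurable this] with ω h
  exact Set.encard_ne_top_iff.1 h

theorem IsHPPP.lintegral_eexpNeg_count [IsProbabilityMeasure μ] (hX : IsHPPP μ lam X)
    {B : Set Plane} (hB : MeasurableSet B) (hB' : volume B ≠ ∞) (c : ℝ≥0∞) :
    ∫⁻ ω, eexpNeg (c * (count X B ω : ℝ≥0∞)) ∂μ =
      eexpNeg (ENNReal.ofReal lam * volume B * (1 - eexpNeg c)) := by
  have hc := measurable_count hX.measurable hB
  rw [← lintegral_map (f := fun a : ℕ∞ => eexpNeg (c * (a : ℝ≥0∞))) .of_discrete hc,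
    hX.map_count hB hB', lintegral_map .of_discrete .of_discrete]
  simp only [ENat.toENNReal_coe]
  rw [lintegral_eexpNeg_poisson, ENNReal.coe_mul, ENNReal.coe_toNNReal hB']
  rfl

/-- The Laplace functional of a homogeneous Poisson process at a simple function with bounded
support. -/
theorem IsHPPP.lintegral_eexpNeg_simpleFunc [IsProbabilityMeasure μ] (hX : IsHPPP μ lam X)
    {K : Set Plane} (hK : MeasurableSet K) (hK' : volume K ≠ ∞) (f : SimpleFunc Plane ℝ≥0∞) :
    ∫⁻ ω, eexpNeg (∑' n, K.indicator f (X n ω)) ∂μ =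
      eexpNeg (ENNReal.ofReal lam * ∫⁻ x, 1 - eexpNeg (K.indicator f x)) := by
  set e := f.range.equivFin
  set c : Fin f.range.card → ℝ≥0∞ := fun i => (e.symm i : ℝ≥0∞)
  set B : Fin f.range.card → Set Plane := fun i => f ⁻¹' {c i} ∩ K with hBdef
  have hB : ∀ i, MeasurableSet (B i) := fun i => (f.measurableSet_fiber _).inter hK
  have hB' : ∀ i, volume (B i) ≠ ∞ := fun i =>
    ne_top_of_le_ne_top hK' (measure_mono Set.inter_subset_right)
  have hdisj : Pairwise (Function.onFun Disjoint B) := by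
    intro i j hij
    refine Set.disjoint_left.2 fun x hx hx' => hij ?_
    have h1 : f x = c i := hx.1
    have h2 : f x = c j := hx'.1
    exact e.symm.injective (Subtype.ext (h1.symm.trans h2))
  have hmem : ∀ x ∈ K, ∃ i, x ∈ B i := fun x hx =>
    ⟨e ⟨f x, f.mem_range_self x⟩, by simp [B, c, hx]⟩
  -- Needed twice: with `F = id` for the sum over the points, and with `F t = 1 - eexpNeg t` for the
  -- intensity integral. The condition `F 0 = 0` disposes of the points outside `K`.
  have hsum : ∀ (F : ℝ≥0∞ → ℝ≥0∞) (_ : F 0 = 0) (x : Plane),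
      F (K.indicator f x) = ∑ i, (B i).indicator (fun _ => F (c i)) x := by
    intro F hF x
    by_cases hx : x ∈ K
    · obtain ⟨i, hi⟩ := hmem x hx
      rw [Finset.sum_eq_single i]
      · rw [Set.indicator_of_mem hx, Set.indicator_of_mem hi]
        exact congrArg F hi.1
      · intro j _ hj
        exact Set.indicator_of_notMem (fun h => Set.disjoint_left.1 (hdisj hj) h hi) _
      · simp
    · rw [Set.indicator_of_notMem hx, hF]
      symm
      exact Finset.sum_eq_zero fun i _ => Set.indicator_of_notMem (fun h => hx h.2) _
  have h1 : ∀ ω, eexpNeg (∑' n, K.indicator f (X n ω)) =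
      ∏ i, eexpNeg (c i * (count X (B i) ω : ℝ≥0∞)) := by
    intro ω
    rw [← eexpNeg_sum]
    congr 1
    simp_rw [← tsum_indicator_eq_count]
    rw [← Summable.tsum_finsetSum (fun _ _ => ENNReal.summable)]
    exact tsum_congr fun n => hsum id rfl _
  simp_rw [h1]
  have hind := (hX.indep _ B hB hdisj).comp (fun i (a : ℕ∞) => eexpNeg (c i * (a : ℝ≥0∞)))
    (fun _ => .of_discrete)
  have h2 := lintegral_prod_eq_prod_lintegral_of_indepFun Finset.univ _ hind
    (fun i => Measurable.of_discrete.comp (measurable_count hX.measurable (hB i)))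
  simp only [Function.comp_def] at h2
  rw [h2]
  simp_rw [hX.lintegral_eexpNeg_count (hB _) (hB' _)]
  rw [← eexpNeg_sum]
  congr 1
  simp_rw [hsum (fun t => 1 - eexpNeg t) (by simp)]
  rw [lintegral_finsetSum _ (fun i _ => measurable_const.indicator (hB i)), Finset.mul_sum]
  refine Finset.sum_congr rfl fun i _ => ?_
  rw [lintegral_indicator_const (hB i), mul_assoc, mul_comm (volume _)]

/-- Monotone convergence for the counting measure on `ℕ`. -/
theorem tendsto_tsum_of_monotone {f : ℕ → ℕ → ℝ≥0∞} {g : ℕ → ℝ≥0∞}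
    (hm : ∀ n, Monotone fun k => f k n) (h : ∀ n, Tendsto (fun k => f k n) atTop (𝓝 (g n))) :
    Tendsto (fun k => ∑' n, f k n) atTop (𝓝 (∑' n, g n)) := by
  simp_rw [← lintegral_count]
  exact lintegral_tendsto_of_tendsto_of_monotone (fun _ => (measurable_of_countable _).aemeasurable)
    (ae_of_all _ hm) (ae_of_all _ h)

/-- The Laplace functional of a homogeneous Poisson process. -/
theorem IsHPPP.lintegral_eexpNeg_tsum [IsProbabilityMeasure μ] (hX : IsHPPP μ lam X)
    {φ : Plane → ℝ≥0∞} (hφ : Measurable φ) :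
    ∫⁻ ω, eexpNeg (∑' n, φ (X n ω)) ∂μ =
      eexpNeg (ENNReal.ofReal lam * ∫⁻ x, 1 - eexpNeg (φ x)) := by
  set K : ℕ → Set Plane := fun k => Metric.closedBall 0 k
  have hK : ∀ k, MeasurableSet (K k) := fun k => Metric.isClosed_closedBall.measurableSet
  have hK' : ∀ k, volume (K k) ≠ ∞ := fun k => measure_closedBall_lt_top.ne
  have hKm : Monotone K := fun i j h => Metric.closedBall_subset_closedBall (by exact_mod_cast h)
  -- Truncating in space and in value at the same time keeps the approximation increasing. The left
  -- side then converges by domination by `1`, the intensity integral by monotone convergence.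
  set f : ℕ → Plane → ℝ≥0∞ := fun k => (K k).indicator (SimpleFunc.eapprox φ k)
  have hf : ∀ k, Measurable (f k) := fun k => (SimpleFunc.measurable _).indicator (hK k)
  have hfm : ∀ x, Monotone fun k => f k x := by
    intro x i j hij
    refine (Set.indicator_le_indicator_of_subset (hKm hij) (fun _ => bot_le) x).trans ?_
    exact Set.indicator_le_indicator (SimpleFunc.monotone_eapprox φ hij x)
  have hft : ∀ x, Tendsto (fun k => f k x) atTop (𝓝 (φ x)) := by
    intro x
    have h1 : Tendsto (fun k => SimpleFunc.eapprox φ k x) atTop (𝓝 (φ x)) := by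
      rw [← SimpleFunc.iSup_eapprox_apply hφ x]
      exact tendsto_atTop_iSup fun i j hij => SimpleFunc.monotone_eapprox φ hij x
    refine h1.congr' ?_
    filter_upwards [eventually_ge_atTop ⌈‖x‖⌉₊] with k hk
    have : x ∈ K k := by
      simpa [K] using (Nat.le_ceil ‖x‖).trans (by exact_mod_cast hk)
    simp [f, this]
  have hl : Tendsto (fun k => ∫⁻ ω, eexpNeg (∑' n, f k (X n ω)) ∂μ) atTop
      (𝓝 (∫⁻ ω, eexpNeg (∑' n, φ (X n ω)) ∂μ)) := by
    refine tendsto_lintegral_of_dominated_convergence (fun _ => 1) (fun k => ?_)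
      (fun k => ae_of_all _ fun ω => eexpNeg_le_one _) (by simp) (ae_of_all _ fun ω => ?_)
    · exact measurable_eexpNeg.comp (Measurable.tsum fun n => (hf k).comp (hX.measurable n))
    · exact (continuous_eexpNeg.tendsto _).comp
        (tendsto_tsum_of_monotone (fun n => hfm _) (fun n => hft _))
  have hr : Tendsto (fun k => eexpNeg (ENNReal.ofReal lam * ∫⁻ x, 1 - eexpNeg (f k x))) atTop
      (𝓝 (eexpNeg (ENNReal.ofReal lam * ∫⁻ x, 1 - eexpNeg (φ x)))) := by
    refine (continuous_eexpNeg.tendsto _).comp ?_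
    refine ENNReal.Tendsto.const_mul ?_ (Or.inr ENNReal.ofReal_ne_top)
    refine lintegral_tendsto_of_tendsto_of_monotone (fun k => ?_) (ae_of_all _ fun x => ?_)
      (ae_of_all _ fun x => ?_)
    · exact (measurable_const.sub (measurable_eexpNeg.comp (hf k))).aemeasurable
    · exact fun i j hij => tsub_le_tsub_left (eexpNeg_antitone (hfm x hij)) _
    · exact ENNReal.Tendsto.sub tendsto_const_nhds
        ((continuous_eexpNeg.tendsto _).comp (hft x)) (Or.inl ENNReal.one_ne_top)
  refine tendsto_nhds_unique hl (hr.congr fun k => ?_)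
  exact (hX.lintegral_eexpNeg_simpleFunc (hK k) (hK' k) _).symm

end HPPP

/-! ### Independent marking -/

/-- The points `Z 0, Z 1, …` have the Laplace functional of a Poisson process with intensity
measure `Λ`. -/
structure HasPoissonLaplace {Ω E : Type*} [MeasurableSpace Ω] [MeasurableSpace E]
    (μ : Measure Ω) (Λ : Measure E) (Z : ℕ → Ω → E) : Prop where
  measurable : ∀ n, Measurable (Z n)
  lintegral_eq : ∀ φ : E → ℝ≥0∞, Measurable φ →
    ∫⁻ ω, eexpNeg (∑' n, φ (Z n ω)) ∂μ = eexpNeg (∫⁻ z, 1 - eexpNeg (φ z) ∂Λ)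

section Marking

variable {Ω E : Type*} [MeasurableSpace Ω] [MeasurableSpace E] {μ : Measure Ω}

/-- Independence factorises each finite partial product; the partial products are bounded by `1`, so
dominated convergence passes to the infinite sum. Writing the single expectations as `eexpNeg (g n)`
makes the limit of their products another `eexpNeg` of a sum. -/
theorem lintegral_eexpNeg_tsum_of_iIndepFun {M : ℕ → Ω → E} (hM : ∀ n, Measurable (M n))
    (hind : iIndepFun M μ) {f : ℕ → E → ℝ≥0∞} (hf : ∀ n, Measurable (f n)) {g : ℕ → ℝ≥0∞}
    (hg : ∀ n, ∫⁻ m, eexpNeg (f n m) ∂(μ.map (M n)) = eexpNeg (g n)) :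
    ∫⁻ ω, eexpNeg (∑' n, f n (M n ω)) ∂μ = eexpNeg (∑' n, g n) := by
  have : IsProbabilityMeasure μ := hind.isProbabilityMeasure
  have hmeas : ∀ n, Measurable fun ω => eexpNeg (f n (M n ω)) := fun n =>
    measurable_eexpNeg.comp ((hf n).comp (hM n))
  have hl : Tendsto (fun N => ∫⁻ ω, ∏ i ∈ Finset.range N, eexpNeg (f i (M i ω)) ∂μ) atTop
      (𝓝 (∫⁻ ω, eexpNeg (∑' n, f n (M n ω)) ∂μ)) := by
    refine tendsto_lintegral_of_dominated_convergence (fun _ => 1) (fun k => ?_)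
      (fun k => ae_of_all _ fun ω => ?_) (by simp) (ae_of_all _ fun ω => tendsto_prod_eexpNeg _)
    · exact Finset.measurable_fun_prod _ fun i _ => hmeas i
    · exact Finset.prod_le_one' fun i _ => eexpNeg_le_one _
  refine tendsto_nhds_unique hl ((tendsto_prod_eexpNeg g).congr fun N => ?_)
  have h := lintegral_prod_eq_prod_lintegral_of_indepFun (Finset.range N) _
    (hind.comp (fun n m => eexpNeg (f n m)) fun n => measurable_eexpNeg.comp (hf n)) hmeas
  simp only [Function.comp_def] at h
  rw [h]
  refine Finset.prod_congr rfl fun n _ => ?_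
  rw [← hg n]
  exact lintegral_map (measurable_eexpNeg.comp (hf n)) (hM n)

/-- Independent marking of a homogeneous Poisson process. -/
theorem IsHPPP.marking {lam : ℝ} {X : ℕ → Ω → Plane} [IsProbabilityMeasure μ]
    (hX : IsHPPP μ lam X) {M : ℕ → Ω → E} (hM : ∀ n, Measurable (M n)) (hind : iIndepFun M μ)
    {ν : Measure E} (hν : ∀ n, μ.map (M n) = ν)
    (hXM : IndepFun (fun ω n => X n ω) (fun ω n => M n ω) μ) :
    HasPoissonLaplace μ ((ENNReal.ofReal lam • (volume : Measure Plane)).prod ν)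
      fun n ω => (X n ω, M n ω) := by
  have hνp : IsProbabilityMeasure ν := hν 0 ▸ Measure.isProbabilityMeasure_map (hM 0).aemeasurable
  refine ⟨fun n => (hX.measurable n).prodMk (hM n), fun φ hφ => ?_⟩
  have hXm : Measurable fun ω n => X n ω := measurable_pi_iff.2 hX.measurable
  have hMm : Measurable fun ω n => M n ω := measurable_pi_iff.2 hM
  have heφ : Measurable fun z => eexpNeg (φ z) := measurable_eexpNeg.comp hφ
  obtain ⟨ψ, hψ, hψe⟩ := exists_eexpNeg_eq
  set g : Plane → ℝ≥0∞ := fun x => ∫⁻ m, eexpNeg (φ (x, m)) ∂ν with hg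
  have hgm : Measurable g := heφ.lintegral_prod_right'
  have hg1 : ∀ x, g x ≤ 1 := fun x => by
    refine (lintegral_mono fun m => eexpNeg_le_one _).trans (by simp)
  have hF : Measurable fun z : (ℕ → Plane) × (ℕ → E) => eexpNeg (∑' n, φ (z.1 n, z.2 n)) := by
    refine measurable_eexpNeg.comp (Measurable.tsum fun n => hφ.comp ?_)
    fun_prop
  calc ∫⁻ ω, eexpNeg (∑' n, φ (X n ω, M n ω)) ∂μ
      = ∫⁻ z, eexpNeg (∑' n, φ (z.1 n, z.2 n))
          ∂(μ.map fun ω => ((fun n => X n ω), (fun n => M n ω))) :=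
        (lintegral_map hF (hXm.prodMk hMm)).symm
    _ = ∫⁻ x, ∫⁻ m, eexpNeg (∑' n, φ (x n, m n)) ∂(μ.map fun ω n => M n ω)
          ∂(μ.map fun ω n => X n ω) := by
        rw [hXM.map_prod_eq_prod_map_map hXm.aemeasurable hMm.aemeasurable,
          lintegral_prod _ hF.aemeasurable]
    -- For frozen positions the marks are independent, and the factor of point `n` averages to `g (x
    -- n)`.
    _ = ∫⁻ x, eexpNeg (∑' n, ψ (g (x n))) ∂(μ.map fun ω n => X n ω) := by
        refine lintegral_congr fun x => ?_
        refine (lintegral_map (hF.comp measurable_prodMk_left) hMm).trans ?_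
        refine lintegral_eexpNeg_tsum_of_iIndepFun hM hind
          (f := fun n m => φ (x n, m)) (fun n => hφ.comp measurable_prodMk_left) fun n => ?_
        rw [hν n, hψe _ (hg1 _)]
    _ = ∫⁻ ω, eexpNeg (∑' n, ψ (g (X n ω))) ∂μ := by
        refine lintegral_map (measurable_eexpNeg.comp (Measurable.tsum fun n => ?_)) hXm
        exact hψ.comp (hgm.comp (measurable_pi_apply n))
    _ = eexpNeg (ENNReal.ofReal lam * ∫⁻ x, 1 - g x) := by
        refine (hX.lintegral_eexpNeg_tsum (hψ.comp hgm)).trans ?_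
        simp only [Function.comp_apply, hψe _ (hg1 _)]
    _ = _ := by
        congr 1
        rw [lintegral_prod (fun z => 1 - eexpNeg (φ z)) (measurable_const.sub heφ).aemeasurable,
          lintegral_smul_measure,
          smul_eq_mul]
        congr 1
        refine lintegral_congr fun x => ?_
        have hx : Measurable fun m => eexpNeg (φ (x, m)) := heφ.comp measurable_prodMk_left
        rw [lintegral_sub hx (ne_top_of_le_ne_top ENNReal.one_ne_top (hg1 x))
          (ae_of_all _ fun m => eexpNeg_le_one _)]
        simp [hg]

/-- Both laws are infinite products, and currying an infinite product over `ι × κ` gives the product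
over `ι` of the row products. -/
theorem iIndepFun_rows {ι κ : Type*} {V : ι → κ → Ω → E} (hV : ∀ i j, Measurable (V i j))
    (h : iIndepFun (fun (q : ι × κ) => V q.1 q.2) μ) :
    iIndepFun (fun i ω j => V i j ω) μ := by
  have := h.isProbabilityMeasure
  have hp : ∀ i j, IsProbabilityMeasure (μ.map (V i j)) := fun i j =>
    Measure.isProbabilityMeasure_map (hV i j).aemeasurable
  have hrow : ∀ i, iIndepFun (V i) μ := fun i =>
    h.precomp (g := fun j => (i, j)) (Prod.mk_right_injective i)
  rw [iIndepFun_iff_map_fun_eq_infinitePi_map (by fun_prop)]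
  simp_rw [(iIndepFun_iff_map_fun_eq_infinitePi_map (hV _)).1 (hrow _)]
  rw [← Measure.infinitePi_map_curry (fun i j => μ.map (V i j)),
    ← (iIndepFun_iff_map_fun_eq_infinitePi_map (fun q : ι × κ => hV q.1 q.2)).1 h,
    Measure.map_map (by fun_prop) (by fun_prop)]
  rfl

/-- The two hypotheses make the joint law of the triple a product of three marginals, which may be
regrouped; the regrouping is verified on boxes. -/
theorem IndepFun.prodMk_of_indepFun {E₁ E₂ E₃ : Type*} [MeasurableSpace E₁] [MeasurableSpace E₂]
    [MeasurableSpace E₃] [IsProbabilityMeasure μ] {X : Ω → E₁} {Y : Ω → E₂} {M : Ω → E₃}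
    (hX : Measurable X) (hY : Measurable Y) (hM : Measurable M)
    (hYM : IndepFun Y M μ) (hXYM : IndepFun X (fun ω => (Y ω, M ω)) μ) :
    IndepFun Y (fun ω => (X ω, M ω)) μ := by
  have hp1 := Measure.isProbabilityMeasure_map (μ := μ) hX.aemeasurable
  have hp2 := Measure.isProbabilityMeasure_map (μ := μ) hY.aemeasurable
  have hp3 := Measure.isProbabilityMeasure_map (μ := μ) hM.aemeasurable
  have hXM : IndepFun X M μ := hXYM.comp measurable_id measurable_snd
  rw [indepFun_iff_map_prod_eq_prod_map_map (by fun_prop) (by fun_prop)] at *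
  rw [hXM]
  have h1 : (fun ω => (Y ω, (X ω, M ω))) =
      (fun z : E₁ × (E₂ × E₃) => (z.2.1, (z.1, z.2.2))) ∘ fun ω => (X ω, (Y ω, M ω)) := rfl
  rw [h1, ← Measure.map_map (by fun_prop) (by fun_prop), hXYM, hYM]
  symm
  refine Measure.prod_eq_generateFrom MeasurableSpace.generateFrom_measurableSet generateFrom_prod
    MeasurableSpace.isPiSystem_measurableSet isPiSystem_prod
    (Measure.toFiniteSpanningSetsIn _)
    ((Measure.toFiniteSpanningSetsIn _).prod (Measure.toFiniteSpanningSetsIn _)) ?_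
  rintro s hs _ ⟨t, ht, u, hu, rfl⟩
  rw [Measure.map_apply (by fun_prop) (hs.prod (ht.prod hu))]
  have h2 : (fun z : E₁ × (E₂ × E₃) => (z.2.1, (z.1, z.2.2))) ⁻¹' (s ×ˢ (t ×ˢ u)) =
      t ×ˢ (s ×ˢ u) := by
    ext; simp; tauto
  rw [h2, Measure.prod_prod, Measure.prod_prod, Measure.prod_prod]
  ring

end Marking

/-! ### The marked process of aerial base stations -/

/-- Horizontal position, link variable and fading gains of an ABS. -/
abbrev MarkedPoint : Type := Plane × (ℝ × (ℝ × ℝ))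

/-- Intensity measure of the marked process of aerial base stations. -/
noncomputable def Params.intensity (p : Params) : Measure MarkedPoint :=
  (ENNReal.ofReal p.lamA • (volume : Measure Plane)).prod
    ((volume.restrict (Set.Icc (0 : ℝ) 1)).prod
      ((gammaMeasure p.mL p.mL).prod (gammaMeasure p.mN p.mN)))

namespace Network

variable {Ω : Type*} {net : Network Ω} {p : Params} [MeasurableSpace Ω] {μ : Measure Ω}

/-- Fading marks of ABS `n`. -/
def marks (net : Network Ω) (n : ℕ) (ω : Ω) : ℝ × (ℝ × ℝ) := (net.U n ω, net.HL n ω, net.HN n ω)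

/-- ABS `n` with its marks. -/
def marked (net : Network Ω) (n : ℕ) (ω : Ω) : MarkedPoint := (net.X n ω, net.marks n ω)

theorem IsModel.measurable_marks (h : net.IsModel p μ) (n : ℕ) : Measurable (net.marks n) :=
  (h.measurable_U n).prodMk ((h.measurable_HL n).prodMk (h.measurable_HN n))

/-- The flat independent family of all `U`, `HL`, `HN` is reindexed by station and kind of mark,
then grouped by station. -/
theorem IsModel.iIndepFun_marks (h : net.IsModel p μ) : iIndepFun net.marks μ := by
  set V : ℕ → Fin 3 → Ω → ℝ := fun n => ![net.U n, net.HL n, net.HN n] with hV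
  have hVm : ∀ n j, Measurable (V n j) := by
    intro n j
    fin_cases j
    exacts [h.measurable_U n, h.measurable_HL n, h.measurable_HN n]
  set g : ℕ × Fin 3 → ℕ ⊕ (ℕ ⊕ ℕ) := fun q =>
    ![Sum.inl q.1, Sum.inr (Sum.inl q.1), Sum.inr (Sum.inr q.1)] q.2 with hg
  have hginj : g.Injective := by
    rintro ⟨n, i⟩ ⟨m, j⟩ hnm
    fin_cases i <;> fin_cases j <;> simp_all
  have h1 : iIndepFun (fun q : ℕ × Fin 3 => V q.1 q.2) μ := by
    convert h.indep_marks.precomp hginj using 2 with q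
    obtain ⟨n, j⟩ := q
    fin_cases j <;> simp [hV, hg]
  exact (iIndepFun_rows hVm h1).comp (fun _ v => (v 0, v 1, v 2)) fun _ => by fun_prop

theorem IsModel.map_marks [IsProbabilityMeasure μ] (h : net.IsModel p μ) (n : ℕ) :
    μ.map (net.marks n) = (volume.restrict (Set.Icc (0 : ℝ) 1)).prod
      ((gammaMeasure p.mL p.mL).prod (gammaMeasure p.mN p.mN)) := by
  have hm : ∀ i, Measurable (Sum.elim net.U (Sum.elim net.HL net.HN) i) := by
    rintro (i | i | i)
    exacts [h.measurable_U i, h.measurable_HL i, h.measurable_HN i]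
  have h1 : IndepFun (net.HL n) (net.HN n) μ :=
    h.indep_marks.indepFun (i := Sum.inr (Sum.inl n)) (j := Sum.inr (Sum.inr n)) (by simp)
  have h2 : IndepFun (fun ω => (net.HL n ω, net.HN n ω)) (net.U n) μ :=
    h.indep_marks.indepFun_prodMk hm (Sum.inr (Sum.inl n)) (Sum.inr (Sum.inr n)) (Sum.inl n)
      (by simp) (by simp)
  have h3 := h2.symm.map_prod_eq_prod_map_map (h.measurable_U n).aemeasurable
    ((h.measurable_HL n).prodMk (h.measurable_HN n)).aemeasurable
  rw [h1.map_prod_eq_prod_map_map (h.measurable_HL n).aemeasurable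
    (h.measurable_HN n).aemeasurable, h.law_U, h.law_HL, h.law_HN] at h3
  exact h3

theorem IsModel.hasPoissonLaplace [IsProbabilityMeasure μ] (h : net.IsModel p μ) :
    HasPoissonLaplace μ p.intensity net.marked := by
  refine h.hppp_X.marking h.measurable_marks h.iIndepFun_marks h.map_marks ?_
  exact h.indep_X.comp (ψ := fun (z : (ℕ → Plane) × ((ℕ → ℝ) × ((ℕ → ℝ) × (ℕ → ℝ)))) n =>
    (z.2.1 n, z.2.2.1 n, z.2.2.2 n)) measurable_id (by fun_prop)

/-- The TBSs are independent of the marked process of ABSs. -/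
theorem IsModel.indepFun_Y_marked [IsProbabilityMeasure μ] (h : net.IsModel p μ) :
    IndepFun (fun ω n => net.Y n ω) (fun ω n => net.marked n ω) μ := by
  have h1 := IndepFun.prodMk_of_indepFun (measurable_pi_iff.2 h.hppp_X.measurable)
    (measurable_pi_iff.2 h.hppp_Y.measurable)
    ((measurable_pi_iff.2 h.measurable_U).prodMk
      ((measurable_pi_iff.2 h.measurable_HL).prodMk (measurable_pi_iff.2 h.measurable_HN)))
    h.indep_Y h.indep_X
  exact h1.comp (ψ := fun (z : (ℕ → Plane) × ((ℕ → ℝ) × ((ℕ → ℝ) × (ℕ → ℝ)))) n =>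
    (z.1 n, z.2.1 n, z.2.2.1 n, z.2.2.2 n)) measurable_id (by fun_prop)

end Network

/-! ### A Poisson process has no ties -/

namespace HasPoissonLaplace

variable {Ω E : Type*} [MeasurableSpace Ω] [MeasurableSpace E] {μ : Measure Ω} {Λ : Measure E}
  {Z : ℕ → Ω → E}

/-- The event that at least two points lie in `B`. -/
def twoPoints (Z : ℕ → Ω → E) (B : Set E) : Set Ω := {ω | ∃ n m, n ≠ m ∧ Z n ω ∈ B ∧ Z m ω ∈ B}

theorem measurableSet_twoPoints (h : HasPoissonLaplace μ Λ Z) {B : Set E} (hB : MeasurableSet B) :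
    MeasurableSet (twoPoints Z B) := by
  have : twoPoints Z B = ⋃ n, ⋃ m, ⋃ _ : n ≠ m, Z n ⁻¹' B ∩ Z m ⁻¹' B := by
    ext; simp only [twoPoints, Set.mem_ofPred_eq, Set.mem_iUnion, Set.mem_inter_iff,
      Set.mem_preimage, exists_prop]
  rw [this]
  exact .iUnion fun n => .iUnion fun m => .iUnion fun _ =>
    (h.measurable n hB).inter (h.measurable m hB)

theorem lintegral_eexpNeg_indicator (h : HasPoissonLaplace μ Λ Z) {B : Set E}
    (hB : MeasurableSet B) (c : ℝ≥0∞) :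
    ∫⁻ ω, eexpNeg (∑' n, B.indicator (fun _ => c) (Z n ω)) ∂μ =
      eexpNeg ((1 - eexpNeg c) * Λ B) := by
  rw [h.lintegral_eq _ (measurable_const.indicator hB), ← lintegral_indicator_const hB]
  congr 2
  ext z
  by_cases hz : z ∈ B <;> simp [hz]

/-- For `N` points in `B`, pointwise `1_{N ≥ 2} + 4 · 2 ^ (-N) ≤ 2 + 2 · 1_{N = 0}`. Both
expectations are values of the Laplace functional, at `c = log 2` and `c = ∞`; with `m = Λ B` they
give the bound `2 (1 - exp (-m / 2)) ^ 2 ≤ m ^ 2 / 2`. -/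
theorem measure_twoPoints_le [IsProbabilityMeasure μ] (h : HasPoissonLaplace μ Λ Z) {B : Set E}
    (hB : MeasurableSet B) (hB' : Λ B ≠ ∞) : μ (twoPoints Z B) ≤ Λ B * Λ B := by
  classical
  set c : ℝ≥0∞ := ENNReal.ofReal (Real.log 2)
  have hc : eexpNeg c = 2⁻¹ := by
    rw [eexpNeg_ofReal (Real.log_nonneg (by norm_num)), Real.exp_neg, Real.exp_log (by norm_num),
      ENNReal.ofReal_inv_of_pos (by norm_num)]
    simp
  have hmeas : ∀ c : ℝ≥0∞, Measurable fun ω => eexpNeg (∑' n, B.indicator (fun _ => c) (Z n ω)) :=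
    fun c => measurable_eexpNeg.comp
      (Measurable.tsum fun n => (measurable_const.indicator hB).comp (h.measurable n))
  have key : ∀ ω, (twoPoints Z B).indicator 1 ω +
      4 * eexpNeg (∑' n, B.indicator (fun _ => c) (Z n ω)) ≤
      2 + 2 * eexpNeg (∑' n, B.indicator (fun _ => ∞) (Z n ω)) := by
    intro ω
    by_cases h2 : ω ∈ twoPoints Z B
    · obtain ⟨n, m, hnm, hn, hm⟩ := id h2
      have h3 : c + c ≤ ∑' n, B.indicator (fun _ => c) (Z n ω) := by
        refine le_trans (le_of_eq ?_)
          (ENNReal.sum_le_tsum (f := fun n => B.indicator (fun _ => c) (Z n ω)) {n, m})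
        rw [Finset.sum_pair hnm]
        simp [hn, hm]
      have h4 : 4 * eexpNeg (∑' n, B.indicator (fun _ => c) (Z n ω)) ≤ 1 := by
        refine (mul_le_mul_right (eexpNeg_antitone h3) 4).trans ?_
        rw [eexpNeg_add, hc, ← ENNReal.mul_inv (by simp) (by simp)]
        norm_num
      have h5 : (twoPoints Z B).indicator (1 : Ω → ℝ≥0∞) ω = 1 :=
        Set.indicator_of_mem h2 _
      rw [h5]
      refine (add_le_add_right h4 1).trans ?_
      norm_num
    rw [Set.indicator_of_notMem h2, zero_add]
    by_cases h1 : ∃ n, Z n ω ∈ B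
    · obtain ⟨n, hn⟩ := h1
      have h3 : c ≤ ∑' n, B.indicator (fun _ => c) (Z n ω) := by
        refine le_trans (le_of_eq ?_) (ENNReal.le_tsum n)
        simp [hn]
      refine (mul_le_mul_right (eexpNeg_antitone h3) 4).trans ?_
      rw [hc]
      refine le_trans (le_of_eq ?_) (le_add_right le_rfl)
      rw [show (4 : ℝ≥0∞) = 2 * 2 by norm_num, mul_assoc,
        ENNReal.mul_inv_cancel (by simp) (by simp), mul_one]
    · push Not at h1
      simp [h1]
      norm_num
  have h1 := lintegral_mono (μ := μ) key
  rw [lintegral_add_left (measurable_one.indicator (h.measurableSet_twoPoints hB)),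
    lintegral_indicator_one (h.measurableSet_twoPoints hB), lintegral_const_mul _ (hmeas _),
    lintegral_add_left measurable_const, lintegral_const_mul _ (hmeas _),
    h.lintegral_eexpNeg_indicator hB, h.lintegral_eexpNeg_indicator hB, hc, eexpNeg_top] at h1
  simp only [tsub_zero, one_mul, lintegral_const, measure_univ, mul_one] at h1
  obtain ⟨m, hm0, hm⟩ : ∃ m : ℝ, 0 ≤ m ∧ Λ B = ENNReal.ofReal m :=
    ⟨_, ENNReal.toReal_nonneg, (ENNReal.ofReal_toReal hB').symm⟩
  have hhalf : (1 - 2⁻¹ : ℝ≥0∞) * Λ B = ENNReal.ofReal (m / 2) := by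
    rw [ENNReal.one_sub_inv_two, hm, ENNReal.ofReal_div_of_pos (by norm_num), mul_comm]
    simp [div_eq_mul_inv]
  rw [hhalf, hm, eexpNeg_ofReal (by positivity), eexpNeg_ofReal hm0] at h1
  have h2 := ENNReal.toReal_mono (by finiteness) h1
  rw [ENNReal.toReal_add (by finiteness) (by finiteness), ENNReal.toReal_add (by finiteness)
    (by finiteness)] at h2
  simp only [ENNReal.toReal_mul, ENNReal.toReal_ofNat, ENNReal.toReal_ofReal (Real.exp_pos _).le]
    at h2
  have h3 : Real.exp (-m) = Real.exp (-(m / 2)) ^ 2 := by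
    rw [← Real.exp_nat_mul]; congr 1; push_cast; ring
  have h4 : 1 - m / 2 ≤ Real.exp (-(m / 2)) := by
    linarith [Real.add_one_le_exp (-(m / 2))]
  have h5 : Real.exp (-(m / 2)) ≤ 1 := Real.exp_le_one_iff.2 (by linarith)
  rw [hm, ← ENNReal.ofReal_mul hm0, ← ENNReal.ofReal_toReal (measure_ne_top μ (twoPoints Z B))]
  refine ENNReal.ofReal_le_ofReal ?_
  nlinarith

/-- If the intensity of a Poisson process charges no level set of `σ` and is finite on the sets
`{σ ≤ t}`, then the points have almost surely distinct values of `σ`. -/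
theorem ae_injective [IsProbabilityMeasure μ] (h : HasPoissonLaplace μ Λ Z) {σ : E → ℝ}
    (hσ : Measurable σ) (hfin : ∀ t, Λ {z | σ z ≤ t} ≠ ∞) (hatom : ∀ t, Λ {z | σ z = t} = 0) :
    ∀ᵐ ω ∂μ, ∀ n m, n ≠ m → σ (Z n ω) ≠ σ (Z m ω) := by
  have hle : ∀ t, MeasurableSet {z | σ z ≤ t} := fun t => measurableSet_le hσ measurable_const
  suffices H : ∀ K : ℕ, ∀ᵐ ω ∂μ, ∀ n m, n ≠ m → σ (Z n ω) ≤ K → σ (Z n ω) ≠ σ (Z m ω) by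
    filter_upwards [ae_all_iff.2 H] with ω hω n m hnm
    exact hω ⌈σ (Z n ω)⌉₊ n m hnm (Nat.le_ceil _)
  intro K
  -- A tie puts two points into one cell of mesh `1 / k`. The union bound and `measure_twoPoints_le`
  -- bound its probability by the sum of the squared cell masses, which is the `ρ ⊗ ρ` mass of the
  -- union `D k` of squares around the diagonal. This tends to the mass of the diagonal, zero
  -- because `ρ` has no atoms.
  set ρ : Measure ℝ := (Λ.restrict {z | σ z ≤ K}).map σ with hρ
  have hρf : IsFiniteMeasure ρ := by
    have : IsFiniteMeasure (Λ.restrict {z | σ z ≤ K}) :=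
      ⟨by simpa using (hfin K).lt_top⟩
    infer_instance
  set cell : ℕ → ℤ → Set ℝ := fun k i => {x | ⌊(k : ℝ) * x⌋ = i} with hcell
  have hfl : ∀ k : ℕ, Measurable fun x : ℝ => ⌊(k : ℝ) * x⌋ := fun k =>
    Int.measurable_floor.comp (measurable_const_mul _)
  have hcm : ∀ k i, MeasurableSet (cell k i) := fun k i => hfl k (measurableSet_singleton i)
  set D : ℕ → Set (ℝ × ℝ) := fun k => {q | ⌊(k : ℝ) * q.1⌋ = ⌊(k : ℝ) * q.2⌋} with hD
  have hDm : ∀ k, MeasurableSet (D k) := fun k =>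
    measurableSet_eq_fun ((hfl k).comp measurable_fst) ((hfl k).comp measurable_snd)
  have hdiag : (ρ.prod ρ) (Set.diagonal ℝ) = 0 := by
    rw [Measure.prod_apply measurableSet_diagonal]
    refine lintegral_eq_zero_of_ae_eq_zero (ae_of_all _ fun x => ?_)
    have : Prod.mk x ⁻¹' Set.diagonal ℝ = {x} := by ext y; simp [eq_comm]
    simp only [this, Pi.zero_apply]
    rw [hρ, Measure.map_apply hσ (measurableSet_singleton x)]
    exact nonpos_iff_eq_zero.1 ((Measure.restrict_apply_le _ _).trans (hatom x).le)
  have hDlim : Tendsto (fun k => (ρ.prod ρ) (D k)) atTop (𝓝 0) := by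
    rw [← hdiag, ← lintegral_indicator_one measurableSet_diagonal]
    simp_rw [← lintegral_indicator_one (hDm _)]
    refine tendsto_lintegral_of_dominated_convergence (fun _ => 1)
      (fun k => measurable_one.indicator (hDm k)) (fun k => ae_of_all _ fun q => ?_) (by simp)
      (ae_of_all _ fun q => ?_)
    · exact Set.indicator_le_self' (fun _ _ => zero_le) q
    · refine tendsto_const_nhds.congr' ?_
      by_cases hq : q.1 = q.2
      · refine Eventually.of_forall fun k => ?_
        simp [D, hq, Set.mem_diagonal_iff]
      · obtain ⟨N, hN⟩ := exists_nat_gt (1 / |q.1 - q.2|)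
        filter_upwards [eventually_ge_atTop N] with k hk
        have hpos : 0 < |q.1 - q.2| := abs_pos.2 (sub_ne_zero.2 hq)
        have hk' : 1 < (k : ℝ) * |q.1 - q.2| := by
          rw [div_lt_iff₀ hpos] at hN
          exact hN.trans_le (mul_le_mul_of_nonneg_right (by exact_mod_cast hk) hpos.le)
        have hne : q ∉ D k := fun hqD => by
          have := Int.abs_sub_lt_one_of_floor_eq_floor hqD
          rw [← mul_sub, abs_mul, Nat.abs_cast] at this
          linarith
        rw [Set.indicator_of_notMem hne, Set.indicator_of_notMem (by simpa using hq)]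
  have hbound : ∀ k, μ {ω | ∃ n m, n ≠ m ∧ σ (Z n ω) ≤ K ∧ σ (Z n ω) = σ (Z m ω)} ≤
      (ρ.prod ρ) (D k) := by
    intro k
    have hB : ∀ i, MeasurableSet (σ ⁻¹' cell k i ∩ {z | σ z ≤ K}) := fun i =>
      (hσ (hcm k i)).inter (hle K)
    have hΛ : ∀ i, Λ (σ ⁻¹' cell k i ∩ {z | σ z ≤ K}) = ρ (cell k i) := fun i => by
      rw [hρ, Measure.map_apply hσ (hcm k i), Measure.restrict_apply (hσ (hcm k i))]
    calc _ ≤ μ (⋃ i, twoPoints Z (σ ⁻¹' cell k i ∩ {z | σ z ≤ K})) := by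
          refine measure_mono ?_
          rintro ω ⟨n, m, hnm, hK, heq⟩
          refine Set.mem_iUnion.2 ⟨⌊(k : ℝ) * σ (Z n ω)⌋, n, m, hnm, ⟨rfl, hK⟩, ?_, ?_⟩
          · simp [cell, heq]
          · exact heq.symm.le.trans hK
      _ ≤ ∑' i, μ (twoPoints Z (σ ⁻¹' cell k i ∩ {z | σ z ≤ K})) := measure_iUnion_le _
      _ ≤ ∑' i, ρ (cell k i) * ρ (cell k i) := by
          refine ENNReal.tsum_le_tsum fun i => ?_
          rw [← hΛ]
          exact h.measure_twoPoints_le (hB i) (hΛ i ▸ measure_ne_top _ _)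
      _ = (ρ.prod ρ) (⋃ i, cell k i ×ˢ cell k i) := by
          rw [measure_iUnion _ fun i => (hcm k i).prod (hcm k i)]
          · simp_rw [Measure.prod_prod]
          · intro i j hij
            refine Set.disjoint_left.2 fun q hq hq' => hij ?_
            exact hq.1.symm.trans hq'.1
      _ ≤ (ρ.prod ρ) (D k) := by
          refine measure_mono (Set.iUnion_subset fun i q hq => ?_)
          exact hq.1.trans hq.2.symm
  have hzero : μ {ω | ∃ n m, n ≠ m ∧ σ (Z n ω) ≤ K ∧ σ (Z n ω) = σ (Z m ω)} = 0 :=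
    nonpos_iff_eq_zero.1 (ge_of_tendsto' hDlim hbound)
  refine measure_mono_null ?_ hzero
  intro ω hω
  simp only [Set.mem_compl_iff, Set.mem_ofPred_eq] at hω
  push Not at hω
  exact hω

end HasPoissonLaplace

/-! ### The point of minimal score -/

/-- The gap `b` is the second smallest value if that is at most `a n₀ + 1`, and `a n₀ + 1`
otherwise. It is what makes the discretisation of the minimum exact at fine levels. -/
theorem exists_isolated_min {a : ℕ → ℝ} (hfin : ∀ t, {n | a n ≤ t}.Finite)
    (hinj : ∀ n m, n ≠ m → a n ≠ a m) :
    ∃ n₀, ⨅ n, a n = a n₀ ∧ ∃ b, a n₀ < b ∧ ∀ n, n ≠ n₀ → b ≤ a n := by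
  obtain ⟨n₀, hn₀, hmin⟩ := Set.exists_min_image _ a (hfin (a 0)) ⟨0, le_refl (a 0)⟩
  have hmin' : ∀ n, a n₀ ≤ a n := fun n => by
    by_cases h : a n ≤ a 0
    · exact hmin n h
    · exact le_trans hn₀ (not_le.1 h).le
  refine ⟨n₀, le_antisymm (ciInf_le ⟨a n₀, by rintro _ ⟨n, rfl⟩; exact hmin' n⟩ n₀)
    (le_ciInf hmin'), ?_⟩
  have hfin' : ({n | a n ≤ a n₀ + 1} \ {n₀}).Finite := (hfin _).subset Set.sdiff_subset
  by_cases hne : ({n | a n ≤ a n₀ + 1} \ {n₀}).Nonempty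
  · obtain ⟨m, hm, hmm⟩ := Set.exists_min_image _ a hfin' hne
    refine ⟨a m, lt_of_le_of_ne (hmin' m) (hinj _ _ (Ne.symm hm.2)), fun n hn => ?_⟩
    by_cases h : a n ≤ a n₀ + 1
    · exact hmm n ⟨h, hn⟩
    · exact le_trans hm.1 (not_le.1 h).le
  · refine ⟨a n₀ + 1, by linarith, fun n hn => ?_⟩
    by_contra h
    exact hne ⟨n, (not_le.1 h).le, hn⟩

/-- The right end of the dyadic interval of level `k`, counted from `c`, that contains `s`. -/
noncomputable def dyadicUp (c : ℝ) (k : ℕ) (s : ℝ) : ℝ := c + (⌊2 ^ k * (s - c)⌋ + 1) / 2 ^ k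

/-- Strictness matters: a point of score exactly `s` is thereby excluded from `{dyadicUp c k s ≤
σ}`. -/
theorem lt_dyadicUp (c : ℝ) (k : ℕ) (s : ℝ) : s < dyadicUp c k s := by
  have h : (s - c) < (⌊2 ^ k * (s - c)⌋ + 1) / 2 ^ k := by
    rw [lt_div_iff₀ (by positivity), mul_comm]
    exact Int.lt_floor_add_one _
  unfold dyadicUp; linarith

theorem dyadicUp_le (c : ℝ) (k : ℕ) (s : ℝ) : dyadicUp c k s ≤ s + 1 / 2 ^ k := by
  have h : ((⌊2 ^ k * (s - c)⌋ : ℝ) + 1) / 2 ^ k ≤ (s - c) + 1 / 2 ^ k := by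
    rw [div_le_iff₀ (by positivity), add_mul, one_div, inv_mul_cancel₀ (by positivity),
      mul_comm (s - c)]
    linarith [Int.floor_le (2 ^ k * (s - c))]
  unfold dyadicUp; linarith

/-- Dyadic cells of consecutive levels are nested, so right ends can only move left. This is the
reason for powers of two: it allows monotone convergence in `tendsto_setLIntegral_dyadicUp`. -/
theorem dyadicUp_antitone (c s : ℝ) : Antitone fun k => dyadicUp c k s := by
  refine antitone_nat_of_succ_le fun k => ?_
  have h : 2 * ⌊2 ^ k * (s - c)⌋ + 2 ≥ ⌊2 ^ (k + 1) * (s - c)⌋ + 1 := by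
    have h1 : ⌊2 ^ (k + 1) * (s - c)⌋ < 2 * ⌊2 ^ k * (s - c)⌋ + 2 := by
      rw [Int.floor_lt]
      push_cast
      have := Int.lt_floor_add_one (2 ^ k * (s - c))
      rw [pow_succ]
      linarith
    omega
  have h' : (⌊2 ^ (k + 1) * (s - c)⌋ : ℝ) + 1 ≤ 2 * ⌊2 ^ k * (s - c)⌋ + 2 := by exact_mod_cast h
  simp only [dyadicUp]
  generalize (⌊2 ^ (k + 1) * (s - c)⌋ : ℝ) = x at h'
  rw [add_le_add_iff_left, div_le_div_iff₀ (by positivity) (by positivity), pow_succ]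
  have : (0 : ℝ) < 2 ^ k := by positivity
  nlinarith

theorem tendsto_dyadicUp (c s : ℝ) : Tendsto (fun k => dyadicUp c k s) atTop (𝓝 s) := by
  have h : Tendsto (fun k : ℕ => s + 1 / (2 : ℝ) ^ k) atTop (𝓝 s) := by
    have := (tendsto_pow_atTop_nhds_zero_of_lt_one (r := (1 / 2 : ℝ)) (by norm_num)
      (by norm_num)).const_add s
    simpa using this
  exact tendsto_of_tendsto_of_tendsto_of_le_of_le tendsto_const_nhds h
    (fun k => (lt_dyadicUp c k s).le) fun k => dyadicUp_le c k s

theorem measurable_dyadicUp (c : ℝ) (k : ℕ) : Measurable (dyadicUp c k) := by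
  unfold dyadicUp
  have : Measurable fun s : ℝ => ((⌊2 ^ k * (s - c)⌋ : ℤ) : ℝ) :=
    Measurable.of_discrete.comp (Int.measurable_floor.comp (by fun_prop))
  fun_prop

theorem indicator_congr_mem {α β : Type*} [Zero β] {s t : Set α} {f g : α → β} {x : α}
    (hst : x ∈ s ↔ x ∈ t) (hfg : f x = g x) : s.indicator f x = t.indicator g x := by
  by_cases h : x ∈ s
  · rw [Set.indicator_of_mem h, Set.indicator_of_mem (hst.1 h), hfg]
  · rw [Set.indicator_of_notMem h, Set.indicator_of_notMem (mt hst.2 h)]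

/-! ### Void events, and the law of the other points given the minimal score. -/

namespace HasPoissonLaplace

variable {Ω E : Type*} [MeasurableSpace Ω] [MeasurableSpace E] {μ : Measure Ω} {Λ : Measure E}
  {Z : ℕ → Ω → E}

/-- The event that no point lies in `D`. -/
def void (Z : ℕ → Ω → E) (D : Set E) : Set Ω := {ω | ∀ n, Z n ω ∉ D}

theorem measurableSet_void (h : HasPoissonLaplace μ Λ Z) {D : Set E} (hD : MeasurableSet D) :
    MeasurableSet (void Z D) := by
  have : void Z D = ⋂ n, (Z n ⁻¹' D)ᶜ := by ext; simp [void]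
  rw [this]
  exact .iInter fun n => (h.measurable n hD).compl

/-- A void event is independent of the points outside. -/
theorem setLIntegral_void (h : HasPoissonLaplace μ Λ Z) {D : Set E} (hD : MeasurableSet D)
    {φ : E → ℝ≥0∞} (hφ : Measurable φ) (hφD : ∀ z ∈ D, φ z = 0) :
    ∫⁻ ω in void Z D, eexpNeg (∑' n, φ (Z n ω)) ∂μ =
      μ (void Z D) * eexpNeg (∫⁻ z, 1 - eexpNeg (φ z) ∂Λ) := by
  -- The indicator of a void event is itself an exponential: a weight `∞` on `D` kills every
  -- configuration charging `D`. The Laplace functional at `φ + ∞ · 1_D` then yields the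
  -- factorisation, as the two supports are disjoint.
  have hi : ∀ φ' : E → ℝ≥0∞, ∀ ω, (void Z D).indicator (fun ω => eexpNeg (∑' n, φ' (Z n ω))) ω =
      eexpNeg (∑' n, (φ' (Z n ω) + D.indicator (fun _ => ∞) (Z n ω))) := by
    intro φ' ω
    by_cases hω : ω ∈ void Z D
    · rw [Set.indicator_of_mem hω]
      congr 1
      refine tsum_congr fun n => ?_
      rw [Set.indicator_of_notMem (hω n), add_zero]
    · rw [Set.indicator_of_notMem hω]
      obtain ⟨n, hn⟩ : ∃ n, Z n ω ∈ D := by simpa [void] using hω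
      have : ∑' n, (φ' (Z n ω) + D.indicator (fun _ => ∞) (Z n ω)) = ∞ := by
        refine ENNReal.tsum_eq_top_of_eq_top ⟨n, ?_⟩
        simp [hn]
      simp [this]
  have hDi : Measurable (D.indicator fun _ => (∞ : ℝ≥0∞)) := measurable_const.indicator hD
  have hvoid : μ (void Z D) = eexpNeg (∫⁻ z, 1 - eexpNeg (D.indicator (fun _ => ∞) z) ∂Λ) := by
    rw [← h.lintegral_eq _ hDi, ← lintegral_indicator_one (h.measurableSet_void hD)]
    refine lintegral_congr fun ω => ?_
    have := hi (fun _ => 0) ω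
    simp only [tsum_zero, eexpNeg_zero, zero_add] at this
    exact this
  rw [← lintegral_indicator (h.measurableSet_void hD)]
  simp_rw [hi φ]
  rw [h.lintegral_eq (fun z => φ z + D.indicator (fun _ => ∞) z) (hφ.add hDi), hvoid,
    ← eexpNeg_add, ← lintegral_add_left (f := fun z => 1 - eexpNeg (D.indicator (fun _ => ∞) z))
      (measurable_const.sub (measurable_eexpNeg.comp hDi))]
  congr 1
  refine lintegral_congr fun z => ?_
  by_cases hz : z ∈ D
  · simp [hz, hφD z hz]
  · simp [hz]

/-- Subtract the factorisations for the two nested void events; the subtracted term is finite. -/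
theorem setLIntegral_void_diff [IsProbabilityMeasure μ] (h : HasPoissonLaplace μ Λ Z)
    {D₁ D₂ : Set E} (hD₁ : MeasurableSet D₁) (hD₂ : MeasurableSet D₂) (h12 : D₁ ⊆ D₂)
    {φ : E → ℝ≥0∞} (hφ : Measurable φ) (hφD : ∀ z ∈ D₂, φ z = 0) :
    ∫⁻ ω in void Z D₁ \ void Z D₂, eexpNeg (∑' n, φ (Z n ω)) ∂μ =
      μ (void Z D₁ \ void Z D₂) * eexpNeg (∫⁻ z, 1 - eexpNeg (φ z) ∂Λ) := by
  have hsub : void Z D₂ ⊆ void Z D₁ := fun ω hω n hn => hω n (h12 hn)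
  have hV₂ := h.measurableSet_void hD₂
  have h1 := lintegral_inter_add_sdiff (μ := μ) (fun ω => eexpNeg (∑' n, φ (Z n ω)))
    (void Z D₁) hV₂
  have h2 := measure_inter_add_sdiff (μ := μ) (void Z D₁) hV₂
  rw [Set.inter_eq_self_of_subset_right hsub] at h1 h2
  rw [h.setLIntegral_void hD₁ hφ fun z hz => hφD z (h12 hz), h.setLIntegral_void hD₂ hφ hφD,
    ← h2, add_mul] at h1
  exact (ENNReal.add_right_inj (ENNReal.mul_ne_top (measure_ne_top _ _) (eexpNeg_ne_top _))).1 h1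

/-- The minimal score. -/
noncomputable def minScore (Z : ℕ → Ω → E) (σ : E → ℝ) (ω : Ω) : ℝ := ⨅ n, σ (Z n ω)

/-- The event that the minimal score is attained by a point in `C`. -/
def minIn (Z : ℕ → Ω → E) (σ : E → ℝ) (C : Set E) : Set Ω :=
  {ω | ∃ n, Z n ω ∈ C ∧ σ (Z n ω) = minScore Z σ ω}

theorem measurable_minScore (hZ : ∀ n, Measurable (Z n)) {σ : E → ℝ} (hσ : Measurable σ) :
    Measurable (minScore Z σ) :=
  Measurable.iInf fun n => hσ.comp (hZ n)

theorem measurableSet_minIn (hZ : ∀ n, Measurable (Z n)) {σ : E → ℝ} (hσ : Measurable σ)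
    {C : Set E} (hC : MeasurableSet C) : MeasurableSet (minIn Z σ C) := by
  have : minIn Z σ C = ⋃ n, Z n ⁻¹' C ∩ {ω | σ (Z n ω) = minScore Z σ ω} := by
    ext; simp [minIn]
  rw [this]
  exact .iUnion fun n => (hZ n hC).inter
    (measurableSet_eq_fun (hσ.comp (hZ n)) (measurable_minScore hZ hσ))

theorem measurable_tsum_minScore_lt (hZ : ∀ n, Measurable (Z n)) {σ : E → ℝ} (hσ : Measurable σ)
    {φ : E → ℝ≥0∞} (hφ : Measurable φ) :
    Measurable fun ω => ∑' n, {z | minScore Z σ ω < σ z}.indicator φ (Z n ω) := by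
  refine Measurable.tsum fun n => ?_
  simp only [Set.indicator_apply, Set.mem_ofPred_eq]
  exact Measurable.ite (measurableSet_lt (measurable_minScore hZ hσ) (hσ.comp (hZ n)))
    (hφ.comp (hZ n)) measurable_const

theorem le_minScore_iff {Ω E : Type*} {Z : ℕ → Ω → E} {σ : E → ℝ} (h0 : ∀ z, 0 ≤ σ z) {a : ℝ} {ω : Ω} :
    a ≤ minScore Z σ ω ↔ ∀ n, a ≤ σ (Z n ω) :=
  le_ciInf_iff ⟨0, by rintro _ ⟨n, rfl⟩; exact h0 _⟩

/-- The event is "no point in `{σ < a} ∪ (Cᶜ ∩ {σ < b})`, but some point in `{σ < b}`", which only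
concerns scores below `b`, while the sum only concerns scores at least `b`. The void condition on
`Cᶜ` stands in for "the minimal point lies in `C`", with which it agrees in the limit of small
cells. -/
theorem setLIntegral_minScore_cell [IsProbabilityMeasure μ] (h : HasPoissonLaplace μ Λ Z)
    {σ : E → ℝ} (hσ : Measurable σ) (h0 : ∀ z, 0 ≤ σ z) {C : Set E} (hC : MeasurableSet C)
    {φ : E → ℝ≥0∞} (hφ : Measurable φ) {a b : ℝ} (hab : a ≤ b) :
    ∫⁻ ω in {ω | a ≤ minScore Z σ ω ∧ minScore Z σ ω < b},
        (void Z (Cᶜ ∩ {z | σ z < b})).indicator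
          (fun ω => eexpNeg (∑' n, {z | b ≤ σ z}.indicator φ (Z n ω))) ω ∂μ =
      ∫⁻ ω in {ω | a ≤ minScore Z σ ω ∧ minScore Z σ ω < b},
        (void Z (Cᶜ ∩ {z | σ z < b})).indicator
          (fun _ => eexpNeg (∫⁻ z in {z | b ≤ σ z}, 1 - eexpNeg (φ z) ∂Λ)) ω ∂μ := by
  have hlt : ∀ t, MeasurableSet {z | σ z < t} := fun t => measurableSet_lt hσ measurable_const
  have hge : MeasurableSet {z | b ≤ σ z} := measurableSet_le measurable_const hσ
  have hV := h.measurableSet_void (hC.compl.inter (hlt b))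
  have hset : void Z (Cᶜ ∩ {z | σ z < b}) ∩ {ω | a ≤ minScore Z σ ω ∧ minScore Z σ ω < b} =
      void Z ({z | σ z < a} ∪ (Cᶜ ∩ {z | σ z < b})) \ void Z {z | σ z < b} := by
    ext ω
    have h1 : minScore Z σ ω < b ↔ ∃ n, σ (Z n ω) < b := by
      rw [← not_le, le_minScore_iff h0]; push Not; rfl
    simp only [Set.mem_inter_iff, Set.mem_ofPred_eq, h1, le_minScore_iff h0, void, Set.mem_sdiff,
      Set.mem_union, not_or, not_lt, forall_and, not_forall, not_le]
    tauto
  rw [lintegral_indicator hV, lintegral_indicator hV, Measure.restrict_restrict hV, hset,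
    h.setLIntegral_void_diff ((hlt a).union (hC.compl.inter (hlt b))) (hlt b) _
      (hφ.indicator hge) _, setLIntegral_const, mul_comm]
  · congr 2
    rw [← lintegral_indicator hge]
    refine lintegral_congr fun z => ?_
    by_cases hz : b ≤ σ z <;> simp [hz]
  · rintro z (hz | hz)
    · exact lt_of_lt_of_le hz hab
    · exact hz.2
  · intro z hz
    have hz' : z ∉ {z | b ≤ σ z} := fun h : b ≤ σ z => absurd hz (not_lt.2 h)
    exact Set.indicator_of_notMem hz' _

/-- Summation of the cell identity over level `k`. The grid is counted from `c` so that `{c ≤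
minScore}` is exactly a union of cells. -/
theorem setLIntegral_minScore_dyadic [IsProbabilityMeasure μ] (h : HasPoissonLaplace μ Λ Z)
    {σ : E → ℝ} (hσ : Measurable σ) (h0 : ∀ z, 0 ≤ σ z) {C : Set E} (hC : MeasurableSet C)
    {φ : E → ℝ≥0∞} (hφ : Measurable φ) (c : ℝ) (k : ℕ) :
    ∫⁻ ω in {ω | c ≤ minScore Z σ ω},
        {ω | ∀ n, Z n ω ∉ C → dyadicUp c k (minScore Z σ ω) ≤ σ (Z n ω)}.indicator
          (fun ω => eexpNeg (∑' n,
            {z | dyadicUp c k (minScore Z σ ω) ≤ σ z}.indicator φ (Z n ω))) ω ∂μ =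
      ∫⁻ ω in {ω | c ≤ minScore Z σ ω},
        {ω | ∀ n, Z n ω ∉ C → dyadicUp c k (minScore Z σ ω) ≤ σ (Z n ω)}.indicator
          (fun ω => eexpNeg (∫⁻ z in {z | dyadicUp c k (minScore Z σ ω) ≤ σ z},
            1 - eexpNeg (φ z) ∂Λ)) ω ∂μ := by
  set a : ℕ → ℝ := fun i => c + i / 2 ^ k
  set b : ℕ → ℝ := fun i => c + (i + 1) / 2 ^ k
  set A : ℕ → Set Ω := fun i => {ω | a i ≤ minScore Z σ ω ∧ minScore Z σ ω < b i} with hA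
  have hS := measurable_minScore h.measurable hσ
  have hp : (0 : ℝ) < 2 ^ k := by positivity
  have hAm : ∀ i, MeasurableSet (A i) := fun i =>
    (measurableSet_le measurable_const hS).inter (measurableSet_lt hS measurable_const)
  have hmem : ∀ i ω, ω ∈ A i ↔ ⌊2 ^ k * (minScore Z σ ω - c)⌋ = i := by
    intro i ω
    rw [Int.floor_eq_iff]
    simp only [hA, a, b, Set.mem_ofPred_eq, Int.cast_natCast]
    refine and_congr ?_ ?_
    · rw [← le_sub_iff_add_le', div_le_iff₀ hp, mul_comm]
    · rw [← sub_lt_iff_lt_add', lt_div_iff₀ hp, mul_comm]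
  have hdis : Pairwise (Function.onFun Disjoint A) := by
    intro i j hij
    refine Set.disjoint_left.2 fun ω hi hj => hij ?_
    exact_mod_cast ((hmem i ω).1 hi).symm.trans ((hmem j ω).1 hj)
  have hun : {ω | c ≤ minScore Z σ ω} = ⋃ i, A i := by
    ext ω
    simp only [Set.mem_iUnion, hmem, Set.mem_ofPred_eq]
    constructor
    · intro hc
      have : 0 ≤ ⌊2 ^ k * (minScore Z σ ω - c)⌋ :=
        Int.floor_nonneg.2 (mul_nonneg hp.le (by linarith))
      exact ⟨_, (Int.toNat_of_nonneg this).symm⟩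
    · rintro ⟨i, hi⟩
      have h1 : 0 ≤ ⌊2 ^ k * (minScore Z σ ω - c)⌋ := by omega
      have h2 := nonneg_of_mul_nonneg_right (Int.floor_nonneg.1 h1) hp
      linarith
  have hdy : ∀ i, ∀ ω ∈ A i, dyadicUp c k (minScore Z σ ω) = b i := by
    intro i ω hω
    simp only [dyadicUp, (hmem i ω).1 hω, b, Int.cast_natCast]
  rw [hun, lintegral_iUnion hAm hdis, lintegral_iUnion hAm hdis]
  refine tsum_congr fun i => ?_
  have hcell := h.setLIntegral_minScore_cell hσ h0 hC hφ (a := a i) (b := b i)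
    (by simp only [a, b]; gcongr; linarith)
  have hvoid : ∀ ω ∈ A i, (ω ∈ {ω | ∀ n, Z n ω ∉ C → dyadicUp c k (minScore Z σ ω) ≤ σ (Z n ω)} ↔
      ω ∈ void Z (Cᶜ ∩ {z | σ z < b i})) := by
    intro ω hω
    simp only [void, Set.mem_ofPred_eq, hdy i ω hω, Set.mem_inter_iff, Set.mem_compl_iff, not_and,
      not_lt]
  convert hcell using 1
  · exact setLIntegral_congr_fun (hAm i) fun ω hω =>
      indicator_congr_mem (hvoid ω hω) (by rw [hdy i ω hω])
  · exact setLIntegral_congr_fun (hAm i) fun ω hω =>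
      indicator_congr_mem (hvoid ω hω) (by rw [hdy i ω hω])

/-- The sets `{dyadicUp c k s ≤ σ}` increase with `k` to `{s < σ}`. -/
theorem tendsto_setLIntegral_dyadicUp {σ : E → ℝ} (hσ : Measurable σ) {g : E → ℝ≥0∞}
    (hg : Measurable g) (c s : ℝ) :
    Tendsto (fun k => ∫⁻ z in {z | dyadicUp c k s ≤ σ z}, g z ∂Λ) atTop
      (𝓝 (∫⁻ z in {z | s < σ z}, g z ∂Λ)) := by
  have hm : ∀ t, MeasurableSet {z | t ≤ σ z} := fun t => measurableSet_le measurable_const hσ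
  simp_rw [← lintegral_indicator (hm _), ← lintegral_indicator (measurableSet_lt measurable_const hσ :
    MeasurableSet {z | s < σ z})]
  refine lintegral_tendsto_of_tendsto_of_monotone (fun k => (hg.indicator (hm _)).aemeasurable)
    (ae_of_all _ fun z i j hij => ?_) (ae_of_all _ fun z => ?_)
  · exact Set.indicator_le_indicator_of_subset
      (fun z hz => (dyadicUp_antitone c s hij).trans hz) (fun _ => bot_le) z
  · refine tendsto_const_nhds.congr' ?_
    by_cases hz : s < σ z
    · filter_upwards [(tendsto_dyadicUp c s).eventually (eventually_lt_nhds hz)] with k hk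
      simp [hz, hk.le]
    · refine Eventually.of_forall fun k => ?_
      have : ¬ dyadicUp c k s ≤ σ z := not_le.2 ((not_lt.1 hz).trans_lt (lt_dyadicUp c k s))
      simp [hz, this]

theorem measurable_eexpNeg_setLIntegral_le (σ : E → ℝ) (g : E → ℝ≥0∞) :
    Measurable fun s : ℝ => eexpNeg (∫⁻ z in {z | s ≤ σ z}, g z ∂Λ) :=
  Monotone.measurable fun _ _ hst => eexpNeg_antitone
    (lintegral_mono_set fun _ hz => le_trans hst hz)

theorem measurable_eexpNeg_setLIntegral_lt (σ : E → ℝ) (g : E → ℝ≥0∞) :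
    Measurable fun s : ℝ => eexpNeg (∫⁻ z in {z | s < σ z}, g z ∂Λ) :=
  Monotone.measurable fun _ _ hst => eexpNeg_antitone
    (lintegral_mono_set fun _ hz => lt_of_le_of_lt hst hz)

/-- Limit `k → ∞` of the dyadic identity, by dominated convergence on both sides. -/
theorem setLIntegral_le_minScore [IsProbabilityMeasure μ] (h : HasPoissonLaplace μ Λ Z)
    {σ : E → ℝ} (hσ : Measurable σ) (h0 : ∀ z, 0 ≤ σ z) {C : Set E} (hC : MeasurableSet C)
    {φ : E → ℝ≥0∞} (hφ : Measurable φ)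
    (hfin : ∀ᵐ ω ∂μ, ∀ t, {n | σ (Z n ω) ≤ t}.Finite)
    (hinj : ∀ᵐ ω ∂μ, ∀ n m, n ≠ m → σ (Z n ω) ≠ σ (Z m ω)) (c : ℝ) :
    ∫⁻ ω in {ω | c ≤ minScore Z σ ω}, (minIn Z σ C).indicator
        (fun ω => eexpNeg (∑' n, {z | minScore Z σ ω < σ z}.indicator φ (Z n ω))) ω ∂μ =
      ∫⁻ ω in {ω | c ≤ minScore Z σ ω}, (minIn Z σ C).indicator
        (fun ω => eexpNeg (∫⁻ z in {z | minScore Z σ ω < σ z}, 1 - eexpNeg (φ z) ∂Λ)) ω ∂μ := by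
  have hS := measurable_minScore h.measurable hσ
  have hβ : ∀ k, Measurable fun ω => dyadicUp c k (minScore Z σ ω) := fun k =>
    (measurable_dyadicUp c k).comp hS
  have hσZ : ∀ n, Measurable fun ω => σ (Z n ω) := fun n => hσ.comp (h.measurable n)
  have hW : ∀ k, MeasurableSet
      {ω | ∀ n, Z n ω ∉ C → dyadicUp c k (minScore Z σ ω) ≤ σ (Z n ω)} := by
    intro k
    have : {ω | ∀ n, Z n ω ∉ C → dyadicUp c k (minScore Z σ ω) ≤ σ (Z n ω)} =
        ⋂ n, (Z n ⁻¹' C ∪ {ω | dyadicUp c k (minScore Z σ ω) ≤ σ (Z n ω)}) := by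
      ext ω
      simp only [Set.mem_ofPred_eq, Set.mem_iInter, Set.mem_union, Set.mem_preimage]
      exact forall_congr' fun n => by tauto
    rw [this]
    exact .iInter fun n => (h.measurable n hC).union (measurableSet_le (hβ k) (hσZ n))
  -- Once `dyadicUp` falls below the gap after the unique minimal point, it separates that point
  -- from all others, so the discretised event and the discretised sum are exact.
  have hlocal : ∀ᵐ ω ∂μ, ∀ᶠ k in atTop,
      (ω ∈ {ω | ∀ n, Z n ω ∉ C → dyadicUp c k (minScore Z σ ω) ≤ σ (Z n ω)} ↔
        ω ∈ minIn Z σ C) ∧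
      ∀ n, (dyadicUp c k (minScore Z σ ω) ≤ σ (Z n ω) ↔ minScore Z σ ω < σ (Z n ω)) := by
    filter_upwards [hfin, hinj] with ω hf hi
    obtain ⟨n₀, hn₀, b, hb, hgap⟩ := exists_isolated_min hf hi
    have hn₀' : minScore Z σ ω = σ (Z n₀ ω) := hn₀
    rw [← hn₀'] at hb
    filter_upwards [(tendsto_dyadicUp c (minScore Z σ ω)).eventually (eventually_lt_nhds hb)]
      with k hk
    have hlt := lt_dyadicUp c k (minScore Z σ ω)
    have hiff : ∀ n, (dyadicUp c k (minScore Z σ ω) ≤ σ (Z n ω) ↔ n ≠ n₀) := by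
      intro n
      constructor
      · rintro hle rfl
        rw [← hn₀'] at hle
        exact absurd hle (not_le.2 hlt)
      · intro hn
        exact hk.le.trans (hgap n hn)
    refine ⟨?_, fun n => ?_⟩
    · simp only [Set.mem_ofPred_eq, hiff, minIn]
      constructor
      · intro H
        exact ⟨n₀, by_contra fun hC => H n₀ hC rfl, hn₀'.symm⟩
      · rintro ⟨n, hnC, hn⟩ m hm rfl
        have : n = m := by
          by_contra hne
          exact hi _ _ hne (hn.trans hn₀')
        exact hm (this ▸ hnC)
    · rw [hiff]
      constructor
      · intro hn
        exact hb.trans_le (hgap n hn)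
      · rintro hlt' rfl
        exact absurd hn₀' hlt'.ne
  have hL : Tendsto (fun k => ∫⁻ ω in {ω | c ≤ minScore Z σ ω},
      {ω | ∀ n, Z n ω ∉ C → dyadicUp c k (minScore Z σ ω) ≤ σ (Z n ω)}.indicator
          (fun ω => eexpNeg (∑' n,
            {z | dyadicUp c k (minScore Z σ ω) ≤ σ z}.indicator φ (Z n ω))) ω ∂μ) atTop
      (𝓝 (∫⁻ ω in {ω | c ≤ minScore Z σ ω}, (minIn Z σ C).indicator
        (fun ω => eexpNeg (∑' n, {z | minScore Z σ ω < σ z}.indicator φ (Z n ω))) ω ∂μ)) := by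
    refine tendsto_lintegral_of_dominated_convergence (fun _ => 1) (fun k => ?_)
      (fun k => ae_of_all _ fun ω => ?_) (by simp)
      ((ae_restrict_of_ae hlocal).mono fun ω hω => ?_)
    · refine (measurable_eexpNeg.comp (Measurable.tsum fun n => ?_)).indicator (hW k)
      simp only [Set.indicator_apply, Set.mem_ofPred_eq]
      exact Measurable.ite (measurableSet_le (hβ k) (hσZ n)) (hφ.comp (h.measurable n))
        measurable_const
    · exact Set.indicator_le' (fun _ _ => eexpNeg_le_one _) (fun _ _ => zero_le) ω
    · refine tendsto_const_nhds.congr' ?_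
      filter_upwards [hω] with k hk
      refine indicator_congr_mem hk.1.symm ?_
      simp only [Set.indicator_apply, Set.mem_ofPred_eq, hk.2]
  have hR : Tendsto (fun k => ∫⁻ ω in {ω | c ≤ minScore Z σ ω},
      {ω | ∀ n, Z n ω ∉ C → dyadicUp c k (minScore Z σ ω) ≤ σ (Z n ω)}.indicator
          (fun ω => eexpNeg (∫⁻ z in {z | dyadicUp c k (minScore Z σ ω) ≤ σ z},
            1 - eexpNeg (φ z) ∂Λ)) ω ∂μ) atTop
      (𝓝 (∫⁻ ω in {ω | c ≤ minScore Z σ ω}, (minIn Z σ C).indicator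
        (fun ω => eexpNeg (∫⁻ z in {z | minScore Z σ ω < σ z}, 1 - eexpNeg (φ z) ∂Λ)) ω ∂μ)) := by
    refine tendsto_lintegral_of_dominated_convergence (fun _ => 1) (fun k => ?_)
      (fun k => ae_of_all _ fun ω => ?_) (by simp)
      ((ae_restrict_of_ae hlocal).mono fun ω hω => ?_)
    · exact ((measurable_eexpNeg_setLIntegral_le σ _).comp (hβ k)).indicator (hW k)
    · exact Set.indicator_le' (fun _ _ => eexpNeg_le_one _) (fun _ _ => zero_le) ω
    -- Unlike the sum over the points, the intensity integral need not become constant in `k`; it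
    -- only converges.
    · have hlim := (continuous_eexpNeg.tendsto _).comp (tendsto_setLIntegral_dyadicUp (Λ := Λ) hσ
        (g := fun z => 1 - eexpNeg (φ z)) (measurable_const.sub (measurable_eexpNeg.comp hφ)) c (minScore Z σ ω))
      by_cases hω' : ω ∈ minIn Z σ C
      · rw [Set.indicator_of_mem hω']
        refine hlim.congr' ?_
        filter_upwards [hω] with k hk
        have hmem : ω ∈ {ω | ∀ n, Z n ω ∉ C → dyadicUp c k (minScore Z σ ω) ≤ σ (Z n ω)} :=
          hk.1.2 hω'
        rw [Set.indicator_of_mem hmem]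
        rfl
      · rw [Set.indicator_of_notMem hω']
        refine tendsto_const_nhds.congr' ?_
        filter_upwards [hω] with k hk
        exact (Set.indicator_of_notMem (s := {ω | ∀ n, Z n ω ∉ C →
          dyadicUp c k (minScore Z σ ω) ≤ σ (Z n ω)}) (fun H => hω' (hk.1.1 H)) _).symm
  simp_rw [h.setLIntegral_minScore_dyadic hσ h0 hC hφ] at hL
  exact tendsto_nhds_unique hL hR

/-- Given that the point of minimal score lies in `C`, and given the minimal score `s`, the other
points form a Poisson process on `{σ > s}`. -/
theorem setLIntegral_minIn [IsProbabilityMeasure μ] (h : HasPoissonLaplace μ Λ Z)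
    {σ : E → ℝ} (hσ : Measurable σ) (h0 : ∀ z, 0 ≤ σ z) {C : Set E} (hC : MeasurableSet C)
    {φ : E → ℝ≥0∞} (hφ : Measurable φ)
    (hfin : ∀ᵐ ω ∂μ, ∀ t, {n | σ (Z n ω) ≤ t}.Finite)
    (hinj : ∀ᵐ ω ∂μ, ∀ n m, n ≠ m → σ (Z n ω) ≠ σ (Z m ω)) {q : ℝ → ℝ≥0∞} (hq : Measurable q) :
    ∫⁻ ω in minIn Z σ C, eexpNeg (∑' n, {z | minScore Z σ ω < σ z}.indicator φ (Z n ω)) *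
        q (minScore Z σ ω) ∂μ =
      ∫⁻ ω in minIn Z σ C, eexpNeg (∫⁻ z in {z | minScore Z σ ω < σ z}, 1 - eexpNeg (φ z) ∂Λ) *
        q (minScore Z σ ω) ∂μ := by
  have hS := measurable_minScore h.measurable hσ
  have hE := measurableSet_minIn h.measurable hσ hC
  set F : Ω → ℝ≥0∞ := fun ω => eexpNeg (∑' n, {z | minScore Z σ ω < σ z}.indicator φ (Z n ω))
  set G : Ω → ℝ≥0∞ := fun ω =>
    eexpNeg (∫⁻ z in {z | minScore Z σ ω < σ z}, 1 - eexpNeg (φ z) ∂Λ)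
  have hF : Measurable F :=
    measurable_eexpNeg.comp (measurable_tsum_minScore_lt h.measurable hσ hφ)
  have hG : Measurable G := (measurable_eexpNeg_setLIntegral_lt σ _).comp hS
  -- Both integrals against `q` are taken over images under the minimal score. These finite measures
  -- agree on all `[c, ∞)` by `setLIntegral_le_minScore`, hence everywhere.
  have heq : ((μ.restrict (minIn Z σ C)).withDensity F).map (minScore Z σ) =
      ((μ.restrict (minIn Z σ C)).withDensity G).map (minScore Z σ) := by
    have hfinF : IsFiniteMeasure ((μ.restrict (minIn Z σ C)).withDensity F) := by
      refine isFiniteMeasure_withDensity (ne_top_of_le_ne_top ENNReal.one_ne_top ?_)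
      refine (lintegral_mono fun ω => eexpNeg_le_one _).trans ?_
      simpa using prob_le_one
    refine Measure.ext_of_Ici _ _ fun c => ?_
    rw [Measure.map_apply hS measurableSet_Ici, Measure.map_apply hS measurableSet_Ici,
      withDensity_apply _ (hS measurableSet_Ici), withDensity_apply _ (hS measurableSet_Ici),
      Measure.restrict_restrict (hS measurableSet_Ici), Set.inter_comm,
      ← Measure.restrict_restrict hE, ← lintegral_indicator hE, ← lintegral_indicator hE]
    exact h.setLIntegral_le_minScore hσ h0 hC hφ hfin hinj c
  have h1 : ∀ H : Ω → ℝ≥0∞, Measurable H → ∫⁻ ω in minIn Z σ C, H ω * q (minScore Z σ ω) ∂μ =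
      ∫⁻ s, q s ∂(((μ.restrict (minIn Z σ C)).withDensity H).map (minScore Z σ)) := by
    intro H hH
    rw [lintegral_map hq hS]
    exact (lintegral_withDensity_eq_lintegral_mul _ hH (hq.comp hS)).symm
  rw [h1 F hF, h1 G hG, heq]

end HasPoissonLaplace

/-! ### Evaluation of the intensity integral -/

/-- Integration of a radial function over the plane. -/
theorem lintegral_fun_norm_plane {f : ℝ → ℝ≥0∞} (hf : Measurable f) :
    ∫⁻ x : Plane, f ‖x‖ =
      ENNReal.ofReal (2 * Real.pi) * ∫⁻ r in Set.Ioi 0, ENNReal.ofReal r * f r := by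
  have hfin : Module.finrank ℝ Plane = 2 := finrank_euclideanSpace_fin
  calc ∫⁻ x : Plane, f ‖x‖
      = ∫⁻ x : ({0}ᶜ : Set Plane), f ‖x.1‖ ∂((volume : Measure Plane).comap (↑)) := by
        rw [lintegral_subtype_comap (measurableSet_singleton _).compl fun x => f ‖x‖,
          restrict_compl_singleton]
    _ = ∫⁻ x, f x.2 ∂(volume : Measure Plane).toSphere.prod
          (Measure.volumeIoiPow (Module.finrank ℝ Plane - 1)) := by
        simpa using (volume : Measure Plane).measurePreserving_homeomorphUnitSphereProd
          |>.lintegral_comp_emb (Homeomorph.measurableEmbedding _) (f ∘ Subtype.val ∘ Prod.snd)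
    _ = (volume : Measure Plane).toSphere Set.univ *
          ∫⁻ x : Set.Ioi (0 : ℝ), f x ∂(Measure.volumeIoiPow (Module.finrank ℝ Plane - 1)) := by
        rw [lintegral_prod (fun x : Metric.sphere (0 : Plane) 1 × Set.Ioi (0 : ℝ) => f x.2)
          (hf.comp (measurable_subtype_coe.comp measurable_snd)).aemeasurable]
        simp [mul_comm]
    _ = _ := by
        have hd := lintegral_withDensity_eq_lintegral_mul
          ((volume : Measure ℝ).comap (Subtype.val : Set.Ioi (0 : ℝ) → ℝ))
          (f := fun r : Set.Ioi (0 : ℝ) => ENNReal.ofReal ((r : ℝ) ^ (2 - 1))) (by fun_prop)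
          (hf.comp measurable_subtype_coe)
        simp only [Pi.mul_apply, Function.comp_apply] at hd
        rw [Measure.toSphere_apply_univ, hfin, EuclideanSpace.volume_ball_fin_two,
          Measure.volumeIoiPow, hd]
        rw [lintegral_subtype_comap measurableSet_Ioi fun a => ENNReal.ofReal (a ^ (2 - 1)) * f a]
        simp [ENNReal.ofReal_mul]

/-- Exponential tilting: `exp (-t x)` times the Gamma density of rate `m` is `(m / (m + t)) ^ m`
times the one of rate `m + t`. -/
theorem lintegral_eexpNeg_gamma {m t : ℝ} (hm : 0 < m) (ht : 0 ≤ t) :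
    ∫⁻ x, eexpNeg (ENNReal.ofReal (t * x)) ∂(gammaMeasure m m) =
      ENNReal.ofReal ((1 + t / m) ^ (-m)) := by
  have hmt : 0 < m + t := by linarith
  have hpdf : ∀ r, Measurable (gammaPDF m r) := fun r =>
    (measurable_gammaPDFReal m r).ennreal_ofReal
  rw [gammaMeasure, lintegral_withDensity_eq_lintegral_mul _ (hpdf m) (by fun_prop)]
  have h : ∀ x, (gammaPDF m m * fun x => eexpNeg (ENNReal.ofReal (t * x))) x =
      ENNReal.ofReal ((1 + t / m) ^ (-m)) * gammaPDF m (m + t) x := by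
    intro x
    rw [Pi.mul_apply]
    rcases lt_or_ge x 0 with hx | hx
    · simp [gammaPDF_of_neg hx]
    · have hb : (1 + t / m) ^ (-m) = m ^ m * ((m + t) ^ m)⁻¹ := by
        rw [Real.rpow_neg (by positivity), show 1 + t / m = (m + t) / m by field_simp,
          Real.div_rpow hmt.le hm.le, inv_div, div_eq_mul_inv]
      have hpos : (m + t) ^ m ≠ 0 := (Real.rpow_pos_of_pos hmt m).ne'
      rw [gammaPDF_of_nonneg hx, gammaPDF_of_nonneg hx, eexpNeg_ofReal (by positivity),
        ← ENNReal.ofReal_mul (by positivity), ← ENNReal.ofReal_mul (by positivity), hb]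
      congr 1
      have he : Real.exp (-((m + t) * x)) = Real.exp (-(m * x)) * Real.exp (-(t * x)) := by
        rw [← Real.exp_add]; congr 1; ring
      rw [he]
      field_simp
  simp_rw [h]
  rw [lintegral_const_mul _ (hpdf _),
    lintegral_gammaPDF_eq_one hm hmt, mul_one]

theorem lintegral_one_sub_eexpNeg_gamma {m t : ℝ} (hm : 0 < m) (ht : 0 ≤ t) :
    ∫⁻ x, 1 - eexpNeg (ENNReal.ofReal (t * x)) ∂(gammaMeasure m m) =
      ENNReal.ofReal (1 - (1 + t / m) ^ (-m)) := by
  have := isProbabilityMeasure_gammaMeasure hm hm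
  rw [lintegral_sub (by fun_prop) _ (ae_of_all _ fun x => eexpNeg_le_one _),
    lintegral_eexpNeg_gamma hm ht]
  · simp [ENNReal.ofReal_sub 1 (by positivity : 0 ≤ (1 + t / m) ^ (-m))]
  · rw [lintegral_eexpNeg_gamma hm ht]
    exact ENNReal.ofReal_ne_top

theorem lintegral_uniform_ite {a : ℝ} (ha : a ∈ Set.Icc (0 : ℝ) 1) (A B : ℝ≥0∞) :
    ∫⁻ u in Set.Icc (0 : ℝ) 1, (if u ≤ a then A else B) =
      ENNReal.ofReal a * A + ENNReal.ofReal (1 - a) * B := by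
  have h : ∀ u : ℝ, (if u ≤ a then A else B) =
      (Set.Iic a).indicator (fun _ => A) u + (Set.Ioi a).indicator (fun _ => B) u := by
    intro u
    by_cases hu : u ≤ a
    · simp [hu]
    · simp [hu, not_le.1 hu]
  simp_rw [h]
  rw [lintegral_add_left (measurable_const.indicator measurableSet_Iic),
    lintegral_indicator_const measurableSet_Iic, lintegral_indicator_const measurableSet_Ioi,
    Measure.restrict_apply measurableSet_Iic, Measure.restrict_apply measurableSet_Ioi]
  have h1 : Set.Iic a ∩ Set.Icc 0 1 = Set.Icc 0 a := by
    ext x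
    simp only [Set.mem_inter_iff, Set.mem_Iic, Set.mem_Icc]
    exact ⟨fun h => ⟨h.2.1, h.1⟩, fun h => ⟨h.2, h.1, h.2.trans ha.2⟩⟩
  have h2 : Set.Ioi a ∩ Set.Icc 0 1 = Set.Ioc a 1 := by
    ext x
    simp only [Set.mem_inter_iff, Set.mem_Ioi, Set.mem_Icc, Set.mem_Ioc]
    exact ⟨fun h => ⟨h.1, h.2.2⟩, fun h => ⟨h.1, ha.1.trans h.1.le, h.2⟩⟩
  rw [h1, h2, Real.volume_Icc, Real.volume_Ioc, sub_zero, mul_comm A, mul_comm B]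

namespace Params

variable (p : Params)

/-- Distance of an ABS at horizontal distance `x`. -/
noncomputable def slant (x : ℝ) : ℝ := Real.sqrt (x ^ 2 + p.h ^ 2)

theorem slant_pos (x : ℝ) : 0 < p.slant x :=
  Real.sqrt_pos.2 (by have := p.h_pos; positivity)

theorem etaL_pos : 0 < p.etaL := mul_pos (mul_pos p.an_pos p.PA_pos) p.CL_pos

theorem etaN_pos : 0 < p.etaN := mul_pos (mul_pos p.an_pos p.PA_pos) p.CN_pos

@[fun_prop]
theorem measurable_slant : Measurable p.slant := by unfold slant; fun_prop

theorem slant_rpow_neg (x alpha : ℝ) :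
    p.slant x ^ (-alpha) = ((x ^ 2 + p.h ^ 2) ^ (alpha / 2))⁻¹ := by
  have : 0 ≤ x ^ 2 + p.h ^ 2 := by positivity
  rw [slant, Real.sqrt_eq_rpow, ← Real.rpow_mul this, ← Real.rpow_neg this]
  congr 1; ring

/-- Translates a threshold on the score into one on the horizontal distance. If the threshold
distance is below `h`, `horiz` gives `0` and both sides hold, thanks to `0 < x`. -/
theorem lt_inv_power_iff {eta alpha v x : ℝ} (he : 0 < eta) (ha : 0 < alpha) (hv : 0 ≤ v)
    (hx : 0 < x) :
    v < (eta * p.slant x ^ (-alpha))⁻¹ ↔ p.horiz ((eta * v) ^ (1 / alpha)) < x := by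
  have hD := p.slant_pos x
  have hd : 0 ≤ (eta * v) ^ (1 / alpha) := by positivity
  rw [Real.rpow_neg hD.le, mul_inv, inv_inv, ← div_eq_inv_mul, lt_div_iff₀ he, mul_comm v,
    horiz, Real.sqrt_lt' hx, sub_lt_iff_lt_add, ← Real.lt_sqrt hd]
  change _ ↔ (eta * v) ^ (1 / alpha) < p.slant x
  rw [one_div, Real.rpow_inv_lt_iff_of_pos (by positivity) hD.le ha]

/-- The cut-off by score becomes the lower limit of integration. -/
theorem setLIntegral_radial {eta alpha v m P C s : ℝ} (he : 0 < eta) (ha : 0 < alpha)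
    (hv : 0 ≤ v) (hm : 0 < m) {q : ℝ → ℝ} (hq : ∀ x, 0 ≤ x → 0 ≤ q x) :
    ∫⁻ x in Set.Ioi 0, ENNReal.ofReal x * (ENNReal.ofReal (q x) *
        (if v < (eta * p.slant x ^ (-alpha))⁻¹ then
          ENNReal.ofReal (1 - (1 + s * (P * C * p.slant x ^ (-alpha)) / m) ^ (-m)) else 0)) =
      ∫⁻ x in Set.Ioi (p.horiz ((eta * v) ^ (1 / alpha))), ENNReal.ofReal
        ((1 - (1 + s * P * C / (m * (x ^ 2 + p.h ^ 2) ^ (alpha / 2))) ^ (-m)) * q x * x) := by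
  have hw : 0 ≤ p.horiz ((eta * v) ^ (1 / alpha)) := Real.sqrt_nonneg _
  rw [← lintegral_indicator measurableSet_Ioi, ← lintegral_indicator measurableSet_Ioi]
  refine lintegral_congr fun x => ?_
  by_cases hx : 0 < x
  · rw [Set.indicator_of_mem (show x ∈ Set.Ioi 0 from hx)]
    by_cases hwx : p.horiz ((eta * v) ^ (1 / alpha)) < x
    · rw [if_pos ((p.lt_inv_power_iff he ha hv hx).2 hwx),
        Set.indicator_of_mem (show x ∈ Set.Ioi _ from hwx), ← ENNReal.ofReal_mul (hq x hx.le),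
        ← ENNReal.ofReal_mul hx.le, slant_rpow_neg]
      congr 1
      have : s * (P * C * ((x ^ 2 + p.h ^ 2) ^ (alpha / 2))⁻¹) / m =
          s * P * C / (m * (x ^ 2 + p.h ^ 2) ^ (alpha / 2)) := by
        field_simp
      rw [this]
      ring
    · rw [if_neg fun h => hwx ((p.lt_inv_power_iff he ha hv hx).1 h),
        Set.indicator_of_notMem (show x ∉ Set.Ioi _ from hwx)]
      simp
  · rw [Set.indicator_of_notMem (show x ∉ Set.Ioi 0 from hx),
      Set.indicator_of_notMem (show x ∉ Set.Ioi _ from fun h => hx (hw.trans_lt h))]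

open Classical in
/-- Inverse average received power of a marked ABS. -/
noncomputable def score (z : MarkedPoint) : ℝ :=
  if z.2.1 ≤ p.PL ‖z.1‖ then (p.etaL * p.slant ‖z.1‖ ^ (-p.alphaL))⁻¹
  else (p.etaN * p.slant ‖z.1‖ ^ (-p.alphaN))⁻¹

open Classical in
/-- Interference of a marked ABS, LoS links being weighted by `sL` and NLoS links by `sN`. -/
noncomputable def weighted (sL sN : ℝ) (z : MarkedPoint) : ℝ≥0∞ :=
  if z.2.1 ≤ p.PL ‖z.1‖ then
    ENNReal.ofReal (sL * (p.PA * p.CL * p.slant ‖z.1‖ ^ (-p.alphaL)) * z.2.2.1)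
  else ENNReal.ofReal (sN * (p.PA * p.CN * p.slant ‖z.1‖ ^ (-p.alphaN)) * z.2.2.2)

theorem measurableSet_LoS : MeasurableSet {z : MarkedPoint | z.2.1 ≤ p.PL ‖z.1‖} :=
  measurableSet_le (by fun_prop) (p.PL_measurable.comp (by fun_prop))

theorem measurable_score : Measurable p.score :=
  Measurable.ite p.measurableSet_LoS (by fun_prop) (by fun_prop)

theorem measurable_weighted (sL sN : ℝ) : Measurable (p.weighted sL sN) :=
  Measurable.ite p.measurableSet_LoS (by fun_prop) (by fun_prop)

theorem score_pos (z : MarkedPoint) : 0 < p.score z := by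
  have h1 := p.slant_pos ‖z.1‖
  have h2 := p.etaL_pos
  have h3 := p.etaN_pos
  unfold score
  split_ifs <;> positivity

/-- Laplace transform of the weighted interference of the ABSs of score larger than `v`. -/
theorem eexpNeg_intensity {sL sN v : ℝ} (hsL : 0 ≤ sL) (hsN : 0 ≤ sN) (hv : 0 ≤ v) :
    eexpNeg (∫⁻ z in {z | v < p.score z}, 1 - eexpNeg (p.weighted sL sN z) ∂p.intensity) =
      ENNReal.ofReal (p.factorL sL (p.horiz ((p.etaL * v) ^ (1 / p.alphaL))) *
        p.factorN sN (p.horiz ((p.etaN * v) ^ (1 / p.alphaN)))) := by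
  have hGL := isProbabilityMeasure_gammaMeasure p.mL_pos p.mL_pos
  have hGN := isProbabilityMeasure_gammaMeasure p.mN_pos p.mN_pos
  have hset : MeasurableSet {z | v < p.score z} := measurableSet_lt measurable_const p.measurable_score
  set tL : ℝ → ℝ := fun x => sL * (p.PA * p.CL * p.slant x ^ (-p.alphaL)) with htL
  set tN : ℝ → ℝ := fun x => sN * (p.PA * p.CN * p.slant x ^ (-p.alphaN)) with htN
  have htL0 : ∀ x, 0 ≤ tL x := fun x => by
    have := p.slant_pos x; have := p.PA_pos; have := p.CL_pos
    positivity
  have htN0 : ∀ x, 0 ≤ tN x := fun x => by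
    have := p.slant_pos x; have := p.PA_pos; have := p.CN_pos
    positivity
  set A : ℝ → ℝ≥0∞ := fun x => if v < (p.etaL * p.slant x ^ (-p.alphaL))⁻¹ then
    ENNReal.ofReal (1 - (1 + tL x / p.mL) ^ (-p.mL)) else 0 with hA
  set B : ℝ → ℝ≥0∞ := fun x => if v < (p.etaN * p.slant x ^ (-p.alphaN))⁻¹ then
    ENNReal.ofReal (1 - (1 + tN x / p.mN) ^ (-p.mN)) else 0 with hB
  have hAm : Measurable A := Measurable.ite (measurableSet_lt (by fun_prop) (by fun_prop))
    (by fun_prop) measurable_const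
  have hBm : Measurable B := Measurable.ite (measurableSet_lt (by fun_prop) (by fun_prop))
    (by fun_prop) measurable_const
  have hPL := p.PL_measurable
  have hPN : Measurable p.PN := measurable_const.sub hPL
  have hF : Measurable ({z | v < p.score z}.indicator fun z => 1 - eexpNeg (p.weighted sL sN z)) :=
    (measurable_const.sub (measurable_eexpNeg.comp (p.measurable_weighted sL sN))).indicator hset
  -- At a fixed position, averaging over the uniform mark selects the LoS branch with probability
  -- `PL` and the NLoS branch with `PN`; each branch then involves only its own Gamma gain.
  have hinner : ∀ x : Plane, ∫⁻ m, {z | v < p.score z}.indicator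
      (fun z => 1 - eexpNeg (p.weighted sL sN z)) (x, m)
        ∂((volume.restrict (Set.Icc (0 : ℝ) 1)).prod
          ((gammaMeasure p.mL p.mL).prod (gammaMeasure p.mN p.mN))) =
      ENNReal.ofReal (p.PL ‖x‖) * A ‖x‖ + ENNReal.ofReal (p.PN ‖x‖) * B ‖x‖ := by
    intro x
    rw [lintegral_prod (fun m => {z | v < p.score z}.indicator
      (fun z => 1 - eexpNeg (p.weighted sL sN z)) (x, m))
      (hF.comp measurable_prodMk_left).aemeasurable]
    refine Eq.trans ?_ (lintegral_uniform_ite (p.PL_mem ‖x‖ (norm_nonneg x)) _ _)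
    refine lintegral_congr fun u => ?_
    by_cases hu : u ≤ p.PL ‖x‖
    · rw [if_pos hu]
      simp only [Set.indicator_apply, Set.mem_ofPred_eq, score, weighted, if_pos hu, hA]
      split_ifs with hvs
      · rw [lintegral_prod _ (by fun_prop)]
        simp only [lintegral_const, measure_univ, mul_one]
        exact lintegral_one_sub_eexpNeg_gamma p.mL_pos (htL0 _)
      · simp
    · rw [if_neg hu]
      simp only [Set.indicator_apply, Set.mem_ofPred_eq, score, weighted, if_neg hu, hB]
      split_ifs with hvs
      · rw [lintegral_prod _ (by fun_prop)]
        simp only [lintegral_const, measure_univ, mul_one]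
        exact lintegral_one_sub_eexpNeg_gamma p.mN_pos (htN0 _)
      · simp
  have hlam : ENNReal.ofReal (2 * Real.pi * p.lamA) =
      ENNReal.ofReal p.lamA * ENNReal.ofReal (2 * Real.pi) := by
    rw [mul_comm, ENNReal.ofReal_mul p.lamA_pos.le]
  have hsum : ∫⁻ z in {z | v < p.score z}, 1 - eexpNeg (p.weighted sL sN z) ∂p.intensity =
      ENNReal.ofReal (2 * Real.pi * p.lamA) *
        (∫⁻ x in Set.Ioi (p.horiz ((p.etaL * v) ^ (1 / p.alphaL))), ENNReal.ofReal
          ((1 - (1 + sL * p.PA * p.CL / (p.mL * (x ^ 2 + p.h ^ 2) ^ (p.alphaL / 2))) ^ (-p.mL)) *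
            p.PL x * x)) +
      ENNReal.ofReal (2 * Real.pi * p.lamA) *
        (∫⁻ x in Set.Ioi (p.horiz ((p.etaN * v) ^ (1 / p.alphaN))), ENNReal.ofReal
          ((1 - (1 + sN * p.PA * p.CN / (p.mN * (x ^ 2 + p.h ^ 2) ^ (p.alphaN / 2))) ^ (-p.mN)) *
            p.PN x * x)) := by
    rw [← lintegral_indicator hset, Params.intensity, lintegral_prod _ hF.aemeasurable]
    simp_rw [hinner]
    rw [lintegral_smul_measure, smul_eq_mul, lintegral_fun_norm_plane
      (f := fun r => ENNReal.ofReal (p.PL r) * A r + ENNReal.ofReal (p.PN r) * B r)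
      (by fun_prop), ← mul_assoc, ← hlam]
    simp_rw [mul_add]
    rw [lintegral_add_left (by fun_prop), mul_add]
    congr 2
    · exact p.setLIntegral_radial p.etaL_pos p.alphaL_pos hv p.mL_pos
        fun x hx => (p.PL_mem x hx).1
    · exact p.setLIntegral_radial p.etaN_pos p.alphaN_pos hv p.mN_pos
        fun x hx => sub_nonneg.2 (p.PL_mem x hx).2
  rw [hsum, eexpNeg_add, factorL, factorN, laplaceFactor, laplaceFactor,
    ENNReal.ofReal_mul (expNeg_nonneg _), ofReal_expNeg, ofReal_expNeg]

end Params

/-! ### Regularity of the scores -/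

namespace Params

variable (p : Params)

theorem horiz_eq_of_score {eta alpha v x : ℝ} (he : 0 < eta) (ha : 0 < alpha) (hx : 0 ≤ x)
    (h : v = (eta * p.slant x ^ (-alpha))⁻¹) : p.slant x = (eta * v) ^ (1 / alpha) ∧
      x = p.horiz ((eta * v) ^ (1 / alpha)) := by
  have hD := p.slant_pos x
  have h1 : (eta * v) ^ (1 / alpha) = p.slant x := by
    rw [h, Real.rpow_neg hD.le, mul_inv, inv_inv, mul_inv_cancel_left₀ he.ne', one_div,
      Real.rpow_rpow_inv hD.le ha.ne']
  refine ⟨h1.symm, ?_⟩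
  rw [h1, horiz, slant, Real.sq_sqrt (by positivity), add_sub_cancel_right, Real.sqrt_sq hx]

/-- A score leaves only two possible horizontal distances. Hence level sets lie over two circles,
which are null, and sublevel sets lie over a disc, which has finite mass. -/
theorem norm_eq_of_score (z : MarkedPoint) :
    ‖z.1‖ = p.horiz ((p.etaL * p.score z) ^ (1 / p.alphaL)) ∨
      ‖z.1‖ = p.horiz ((p.etaN * p.score z) ^ (1 / p.alphaN)) := by
  by_cases h : z.2.1 ≤ p.PL ‖z.1‖
  · exact Or.inl (p.horiz_eq_of_score p.etaL_pos p.alphaL_pos (norm_nonneg _)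
      (by simp [score, h])).2
  · exact Or.inr (p.horiz_eq_of_score p.etaN_pos p.alphaN_pos (norm_nonneg _)
      (by simp [score, h])).2

theorem horiz_rpow_mono {eta alpha v t : ℝ} (he : 0 < eta) (ha : 0 < alpha) (hv : 0 ≤ v)
    (hvt : v ≤ t) : p.horiz ((eta * v) ^ (1 / alpha)) ≤ p.horiz ((eta * t) ^ (1 / alpha)) := by
  unfold horiz
  gcongr

theorem exists_norm_le_of_score_le (t : ℝ) :
    ∃ K, ∀ z : MarkedPoint, p.score z ≤ t → z.1 ∈ Metric.closedBall (0 : Plane) K := by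
  refine ⟨max (p.horiz ((p.etaL * t) ^ (1 / p.alphaL))) (p.horiz ((p.etaN * t) ^ (1 / p.alphaN))),
    fun z hz => ?_⟩
  rw [mem_closedBall_zero_iff]
  rcases p.norm_eq_of_score z with h | h
  · rw [h]
    exact (p.horiz_rpow_mono p.etaL_pos p.alphaL_pos (p.score_pos z).le hz).trans (le_max_left _ _)
  · rw [h]
    exact (p.horiz_rpow_mono p.etaN_pos p.alphaN_pos (p.score_pos z).le hz).trans (le_max_right _ _)

theorem intensity_fst_preimage (B : Set Plane) :
    p.intensity {z | z.1 ∈ B} = ENNReal.ofReal p.lamA * volume B := by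
  have hGL := isProbabilityMeasure_gammaMeasure p.mL_pos p.mL_pos
  have hGN := isProbabilityMeasure_gammaMeasure p.mN_pos p.mN_pos
  have h : {z : MarkedPoint | z.1 ∈ B} = B ×ˢ Set.univ := by ext; simp
  rw [h, intensity, Measure.prod_prod, ← Set.univ_prod_univ, Measure.prod_prod]
  simp

theorem intensity_score_le_ne_top (t : ℝ) : p.intensity {z | p.score z ≤ t} ≠ ∞ := by
  obtain ⟨K, hK⟩ := p.exists_norm_le_of_score_le t
  refine ne_top_of_le_ne_top ?_ (measure_mono (show {z | p.score z ≤ t} ⊆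
    {z : MarkedPoint | z.1 ∈ Metric.closedBall (0 : Plane) K} from hK))
  rw [intensity_fst_preimage]
  exact ENNReal.mul_ne_top ENNReal.ofReal_ne_top measure_closedBall_lt_top.ne

theorem intensity_score_eq (t : ℝ) : p.intensity {z | p.score z = t} = 0 := by
  refine measure_mono_null (t := {z : MarkedPoint | z.1 ∈
    Metric.sphere (0 : Plane) (p.horiz ((p.etaL * t) ^ (1 / p.alphaL))) ∪
      Metric.sphere (0 : Plane) (p.horiz ((p.etaN * t) ^ (1 / p.alphaN)))}) ?_ ?_
  · rintro z rfl
    simpa using p.norm_eq_of_score z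
  · rw [intensity_fst_preimage, measure_union_null (Measure.addHaar_sphere _ _ _)
      (Measure.addHaar_sphere _ _ _), mul_zero]

theorem measurable_horiz : Measurable p.horiz := by unfold horiz; fun_prop

theorem laplaceFactor_monotone (lam P h C alpha m : ℝ) (q : ℝ → ℝ) (s : ℝ) :
    Monotone (laplaceFactor lam P h C alpha m q s) := fun _ _ hw =>
  expNeg_antitone (mul_le_mul_right (lintegral_mono_set (Set.Ioi_subset_Ioi hw)) _)

theorem laplaceFactor_zero (lam P h C alpha m : ℝ) (q : ℝ → ℝ) (w : ℝ) :
    laplaceFactor lam P h C alpha m q 0 w = 1 := by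
  simp [laplaceFactor, expNeg]

theorem measurable_factorL (s : ℝ) : Measurable (p.factorL s) :=
  (laplaceFactor_monotone _ _ _ _ _ _ _ s).measurable

theorem measurable_factorN (s : ℝ) : Measurable (p.factorN s) :=
  (laplaceFactor_monotone _ _ _ _ _ _ _ s).measurable

theorem factorL_zero (w : ℝ) : p.factorL 0 w = 1 := laplaceFactor_zero _ _ _ _ _ _ _ w

theorem factorN_zero (w : ℝ) : p.factorN 0 w = 1 := laplaceFactor_zero _ _ _ _ _ _ _ w

theorem measurable_tauLN : Measurable p.tauLN := by unfold tauLN; fun_prop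

theorem measurable_tauNL : Measurable p.tauNL :=
  Measurable.ite measurableSet_Iic measurable_const (by fun_prop)

/-- Origin of the functions `τ`: the distance at which the other class attains the score of a
serving ABS at distance `r`. -/
theorem rpow_threshold {eta eta' alpha alpha' r : ℝ} (he : 0 < eta) (he' : 0 < eta')
    (hr : 0 < r) : (eta' * (eta * r ^ (-alpha))⁻¹) ^ (1 / alpha') =
      (eta' / eta) ^ (1 / alpha') * r ^ (alpha / alpha') := by
  rw [Real.rpow_neg hr.le, mul_inv, inv_inv, ← mul_assoc, ← div_eq_mul_inv,
    Real.mul_rpow (by positivity) (by positivity), ← Real.rpow_mul hr.le, mul_one_div]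

/-- For `r ≤ lLh` the uncapped expression is at most `h`, and `horiz` vanishes there as it does at
`h`; the cap in `tauNL` is therefore invisible after `horiz`. -/
theorem horiz_tauNL {r : ℝ} (hr : 0 < r) :
    p.horiz ((p.etaN / p.etaL) ^ (1 / p.alphaN) * r ^ (p.alphaL / p.alphaN)) =
      p.horiz (p.tauNL r) := by
  have hL := p.etaL_pos
  have hN := p.etaN_pos
  have hh := p.h_pos
  unfold tauNL
  split_ifs with h
  · have hx : (p.etaN / p.etaL) ^ (1 / p.alphaN) * r ^ (p.alphaL / p.alphaN) ≤ p.h := by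
      have h1 : r ^ p.alphaL ≤ p.etaL / p.etaN * p.h ^ p.alphaN := by
        refine (Real.rpow_le_rpow hr.le h p.alphaL_pos.le).trans (le_of_eq ?_)
        rw [lLh, Real.mul_rpow (by positivity) (by positivity), ← Real.rpow_mul (by positivity),
          ← Real.rpow_mul hh.le, one_div_mul_cancel p.alphaL_pos.ne', Real.rpow_one,
          div_mul_cancel₀ _ p.alphaL_pos.ne']
      have h2 : p.etaN / p.etaL * r ^ p.alphaL ≤ p.h ^ p.alphaN := by
        refine (mul_le_mul_of_nonneg_left h1 (by positivity)).trans (le_of_eq ?_)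
        field_simp
      have h3 := Real.rpow_le_rpow (by positivity) h2 (one_div_pos.2 p.alphaN_pos).le
      rwa [Real.mul_rpow (by positivity) (by positivity), ← Real.rpow_mul hr.le, mul_one_div,
        ← Real.rpow_mul hh.le, mul_one_div_cancel p.alphaN_pos.ne', Real.rpow_one] at h3
    have hx0 : 0 ≤ (p.etaN / p.etaL) ^ (1 / p.alphaN) * r ^ (p.alphaL / p.alphaN) := by positivity
    rw [horiz, horiz, Real.sqrt_eq_zero_of_nonpos (by nlinarith), sub_self, Real.sqrt_zero]
  · rfl

end Params

/-! ### The conditional Laplace transform -/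

section CondLaplace

variable {Ω : Type*} [MeasurableSpace Ω] {μ : Measure Ω}

/-- The sets `R ⁻¹' A` make up the conditioning σ-algebra, so the hypothesis is the defining
property of the conditional expectation, before normalisation by `μ B`. -/
theorem condLaplace_ae_eq [IsProbabilityMeasure μ] {B : Set Ω} {R : Ω → ℝ}
    (hR : Measurable R) {I : Ω → ℝ≥0∞} (hI : Measurable I) {s : ℝ} {g : ℝ → ℝ} (hg : Measurable g)
    (hg0 : ∀ r, 0 ≤ g r) (hg1 : ∀ r, g r ≤ 1)
    (h : ∀ A : Set ℝ, MeasurableSet A →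
      ∫⁻ ω in B ∩ R ⁻¹' A, eexpNeg (ENNReal.ofReal s * I ω) ∂μ =
        ∫⁻ ω in B ∩ R ⁻¹' A, ENNReal.ofReal (g (R ω)) ∂μ) :
    condLaplace μ B R I s =ᵐ[cond μ B] fun ω => g (R ω) := by
  -- Conditioning on a null event gives the zero measure, for which every almost-everywhere
  -- statement holds.
  by_cases hB0 : μ B = 0
  · rw [cond_eq_zero_of_meas_eq_zero hB0]
    simp [EventuallyEq]
  have : IsProbabilityMeasure (cond μ B) := cond_isProbabilityMeasure hB0
  have hle : MeasurableSpace.comap R inferInstance ≤ ‹MeasurableSpace Ω› := hR.comap_le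
  have hf : Measurable fun ω => expNeg (ENNReal.ofReal s * I ω) :=
    measurable_expNeg.comp (hI.const_mul _)
  have hgR : Measurable fun ω => g (R ω) := hg.comp hR
  have hint : ∀ f : Ω → ℝ, Measurable f → (∀ ω, 0 ≤ f ω) → (∀ ω, f ω ≤ 1) →
      Integrable f (cond μ B) := fun f hf h0 h1 =>
    Integrable.of_bound hf.aestronglyMeasurable 1
      (ae_of_all _ fun ω => by rw [Real.norm_eq_abs, abs_of_nonneg (h0 ω)]; exact h1 ω)
  have hgi := hint _ hgR (fun ω => hg0 _) (fun ω => hg1 _)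
  refine (ae_eq_condExp_of_forall_setIntegral_eq hle
    (hint _ hf (fun ω => expNeg_nonneg _) (fun ω => expNeg_le_one _))
    (fun _ _ _ => hgi.integrableOn) ?_ ?_).symm
  · rintro _ ⟨A, hA, rfl⟩ -
    rw [integral_eq_lintegral_of_nonneg_ae (ae_of_all _ fun ω => hg0 _)
        hgR.aestronglyMeasurable,
      integral_eq_lintegral_of_nonneg_ae (ae_of_all _ fun ω => expNeg_nonneg _)
        hf.aestronglyMeasurable]
    simp_rw [ofReal_expNeg]
    rw [ProbabilityTheory.cond, Measure.restrict_smul, lintegral_smul_measure, lintegral_smul_measure,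
      Measure.restrict_restrict (hR hA), Set.inter_comm, h A hA]
  · have : Measurable[MeasurableSpace.comap R inferInstance] fun ω => g (R ω) :=
      hg.comp (comap_measurable R)
    exact this.stronglyMeasurable.aestronglyMeasurable

theorem lintegral_indepFun {E₁ E₂ : Type*} [MeasurableSpace E₁] [MeasurableSpace E₂]
    [IsProbabilityMeasure μ] {Y : Ω → E₁} {W : Ω → E₂} (hY : Measurable Y) (hW : Measurable W)
    (hYW : IndepFun Y W μ) {G : E₁ × E₂ → ℝ≥0∞} (hG : Measurable G) :
    ∫⁻ ω, G (Y ω, W ω) ∂μ = ∫⁻ ω, ∫⁻ y, G (y, W ω) ∂(μ.map Y) ∂μ := by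
  have := Measure.isProbabilityMeasure_map (μ := μ) hY.aemeasurable
  have := Measure.isProbabilityMeasure_map (μ := μ) hW.aemeasurable
  rw [← lintegral_map hG (hY.prodMk hW),
    hYW.map_prod_eq_prod_map_map hY.aemeasurable hW.aemeasurable,
    lintegral_prod_symm _ hG.aemeasurable, lintegral_map hG.lintegral_prod_left' hW]

theorem measurable_sInf_of_nonneg {L : ℕ → Set Ω} (hL : ∀ n, MeasurableSet (L n))
    {f : ℕ → Ω → ℝ} (hf : ∀ n, Measurable (f n)) (h0 : ∀ n ω, 0 ≤ f n ω) :
    Measurable fun ω => sInf {r | ∃ n, ω ∈ L n ∧ r = f n ω} := by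
  refine measurable_of_Iio fun c => ?_
  -- The second part accounts for the default `sInf ∅ = 0`, taken when `ω` lies in no `L n`.
  have h : (fun ω => sInf {r | ∃ n, ω ∈ L n ∧ r = f n ω}) ⁻¹' Set.Iio c =
      (⋃ n, L n ∩ {ω | f n ω < c}) ∪ ((⋃ n, L n)ᶜ ∩ {_ω | 0 < c}) := by
    ext ω
    by_cases hne : ∃ n, ω ∈ L n
    · have hne' : {r | ∃ n, ω ∈ L n ∧ r = f n ω}.Nonempty := by
        obtain ⟨n, hn⟩ := hne
        exact ⟨_, n, hn, rfl⟩
      have hbdd : BddBelow {r | ∃ n, ω ∈ L n ∧ r = f n ω} :=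
        ⟨0, by rintro _ ⟨n, -, rfl⟩; exact h0 n ω⟩
      have hmem : ω ∈ ⋃ n, L n := Set.mem_iUnion.2 hne
      simp only [Set.mem_preimage, Set.mem_Iio, csInf_lt_iff hbdd hne', Set.mem_union,
        Set.mem_inter_iff, Set.mem_compl_iff, hmem, not_true_eq_false, false_and, or_false,
        Set.mem_iUnion, Set.mem_ofPred_eq]
      constructor
      · rintro ⟨_, ⟨n, hn, rfl⟩, hc⟩
        exact ⟨n, hn, hc⟩
      · rintro ⟨n, hn, hc⟩
        exact ⟨_, ⟨n, hn, rfl⟩, hc⟩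
    · push Not at hne
      simp [hne]
  rw [h]
  exact (MeasurableSet.iUnion fun n => (hL n).inter (measurableSet_lt (hf n) measurable_const)).union
    ((MeasurableSet.iUnion hL).compl.inter (.const _))

end CondLaplace

/-! ### The network -/

namespace Network

open HasPoissonLaplace

variable {Ω : Type*} [MeasurableSpace Ω] {μ : Measure Ω} {p : Params} {net : Network Ω}

theorem IsModel.measurable_marked (h : net.IsModel p μ) (n : ℕ) : Measurable (net.marked n) :=
  (h.hppp_X.measurable n).prodMk (h.measurable_marks n)

theorem IsModel.ae_finite_score [IsProbabilityMeasure μ] (h : net.IsModel p μ) :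
    ∀ᵐ ω ∂μ, ∀ t, {n | p.score (net.marked n ω) ≤ t}.Finite := by
  have H : ∀ k : ℕ, ∀ᵐ ω ∂μ, {n | net.X n ω ∈ Metric.closedBall (0 : Plane) k}.Finite := fun k =>
    h.hppp_X.ae_finite Metric.isClosed_closedBall.measurableSet measure_closedBall_lt_top.ne
  filter_upwards [ae_all_iff.2 H] with ω hω t
  obtain ⟨K, hK⟩ := p.exists_norm_le_of_score_le t
  refine (hω ⌈K⌉₊).subset fun n hn => ?_
  have hn' : net.X n ω ∈ Metric.closedBall 0 K := hK (net.marked n ω) hn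
  exact mem_closedBall_zero_iff.2 ((mem_closedBall_zero_iff.1 hn').trans (Nat.le_ceil K))

theorem IsModel.ae_injective_score [IsProbabilityMeasure μ] (h : net.IsModel p μ) :
    ∀ᵐ ω ∂μ, ∀ n m, n ≠ m → p.score (net.marked n ω) ≠ p.score (net.marked m ω) :=
  h.hasPoissonLaplace.ae_injective p.measurable_score p.intensity_score_le_ne_top
    p.intensity_score_eq

open Classical in
/-- Average power received from a TBS at `y`. -/
noncomputable def powAt (p : Params) (y : Plane) : ℝ :=
  if ‖y‖ ≤ p.RB then p.etaT * ‖y‖ ^ (-p.alphaT) else 0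

theorem measurable_powAt (p : Params) : Measurable (powAt p) :=
  Measurable.ite (measurableSet_le measurable_norm measurable_const) (by fun_prop) measurable_const

/-- Configurations `y` of TBSs in `T` whose average powers do not exceed `v⁻¹`. -/
def dominated (p : Params) (T : Set (ℕ → Plane)) : Set ((ℕ → Plane) × ℝ) :=
  {q | q.1 ∈ T ∧ ∀ k, powAt p (q.1 k) ≤ q.2⁻¹}

theorem measurableSet_dominated (p : Params) {T : Set (ℕ → Plane)} (hT : MeasurableSet T) :
    MeasurableSet (dominated p T) := by
  have : dominated p T = Prod.fst ⁻¹' T ∩ ⋂ k, {q | powAt p (q.1 k) ≤ q.2⁻¹} := by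
    ext; simp [dominated]
  rw [this]
  exact (measurable_fst hT).inter (.iInter fun k => measurableSet_le
    ((measurable_powAt p).comp (by fun_prop)) (by fun_prop))

/-- By independence, averaging over the TBSs first replaces the event `Q` by the weight `q`, the
probability of its section at the minimal score. With this weight, `setLIntegral_minIn` applies. -/
theorem setLIntegral_minIn_dominated [IsProbabilityMeasure μ] (h : net.IsModel p μ)
    {C : Set MarkedPoint} (hC : MeasurableSet C) {φ : MarkedPoint → ℝ≥0∞} (hφ : Measurable φ)
    {Q : Set ((ℕ → Plane) × ℝ)} (hQ : MeasurableSet Q) :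
    ∫⁻ ω in minIn net.marked p.score C ∩
        {ω | ((fun n => net.Y n ω), minScore net.marked p.score ω) ∈ Q},
        eexpNeg (∑' n, {z | minScore net.marked p.score ω < p.score z}.indicator φ
          (net.marked n ω)) ∂μ =
      ∫⁻ ω in minIn net.marked p.score C ∩
        {ω | ((fun n => net.Y n ω), minScore net.marked p.score ω) ∈ Q},
        eexpNeg (∫⁻ z in {z | minScore net.marked p.score ω < p.score z},
          1 - eexpNeg (φ z) ∂p.intensity) ∂μ := by
  have hY : Measurable fun ω n => net.Y n ω := measurable_pi_iff.2 h.hppp_Y.measurable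
  have hW : Measurable fun ω n => net.marked n ω := measurable_pi_iff.2 h.measurable_marked
  have hYp := Measure.isProbabilityMeasure_map (μ := μ) hY.aemeasurable
  -- The coordinate process on sequence space: minimal score and class event become functions of the
  -- whole marked sequence, to which the independence of the TBSs refers.
  set ζ : ℕ → (ℕ → MarkedPoint) → MarkedPoint := fun n w => w n
  have hζ : ∀ n, Measurable (ζ n) := fun n => measurable_pi_apply n
  have hS := measurable_minScore h.measurable_marked p.measurable_score
  have hS' := measurable_minScore hζ p.measurable_score
  have hE := measurableSet_minIn h.measurable_marked p.measurable_score hC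
  have hE' := measurableSet_minIn hζ p.measurable_score hC
  have hQm : MeasurableSet {ω | ((fun n => net.Y n ω), minScore net.marked p.score ω) ∈ Q} :=
    (hY.prodMk hS) hQ
  set q : ℝ → ℝ≥0∞ := fun v => (μ.map fun ω n => net.Y n ω) ((fun y => (y, v)) ⁻¹' Q) with hq
  have hqm : Measurable q := measurable_measure_prodMk_right hQ
  have key : ∀ K : (ℕ → MarkedPoint) → ℝ≥0∞, Measurable K →
      ∫⁻ ω in minIn net.marked p.score C ∩
          {ω | ((fun n => net.Y n ω), minScore net.marked p.score ω) ∈ Q},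
          K (fun n => net.marked n ω) ∂μ =
        ∫⁻ ω in minIn net.marked p.score C,
          K (fun n => net.marked n ω) * q (minScore net.marked p.score ω) ∂μ := by
    intro K hK
    set G : (ℕ → Plane) × (ℕ → MarkedPoint) → ℝ≥0∞ := fun z =>
      (minIn ζ p.score C).indicator K z.2 * Q.indicator 1 (z.1, minScore ζ p.score z.2) with hG
    have hGm : Measurable G := by
      refine ((hK.indicator hE').comp measurable_snd).mul ?_
      exact (measurable_one.indicator hQ).comp
        (measurable_fst.prodMk (hS'.comp measurable_snd))
    have h1 := lintegral_indepFun hY hW h.indepFun_Y_marked hGm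
    rw [← lintegral_indicator (hE.inter hQm), ← lintegral_indicator hE]
    convert h1 using 1
    · refine lintegral_congr fun ω => ?_
      change _ = (minIn net.marked p.score C).indicator (fun ω => K fun n => net.marked n ω) ω *
        Q.indicator 1 ((fun n => net.Y n ω), minScore net.marked p.score ω)
      by_cases h1 : ω ∈ minIn net.marked p.score C
      · by_cases h2 : ((fun n => net.Y n ω), minScore net.marked p.score ω) ∈ Q
        · rw [Set.indicator_of_mem (Set.mem_inter h1 h2), Set.indicator_of_mem h1,
            Set.indicator_of_mem h2, Pi.one_apply, mul_one]
        · rw [Set.indicator_of_notMem (fun h => h2 h.2), Set.indicator_of_notMem h2, mul_zero]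
      · rw [Set.indicator_of_notMem (fun h => h1 h.1), Set.indicator_of_notMem h1, zero_mul]
    · refine lintegral_congr fun ω => ?_
      have h3 := lintegral_const_mul (μ := μ.map fun ω n => net.Y n ω)
        ((minIn ζ p.score C).indicator K fun n => net.marked n ω)
        (f := fun y => Q.indicator 1 (y, minScore ζ p.score fun n => net.marked n ω))
        ((measurable_one.indicator hQ).comp measurable_prodMk_right)
      refine Eq.trans ?_ h3.symm
      have h2 : ∫⁻ y, Q.indicator 1 (y, minScore ζ p.score fun n => net.marked n ω)
          ∂(μ.map fun ω n => net.Y n ω) = q (minScore net.marked p.score ω) :=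
        lintegral_indicator_one (μ := μ.map fun ω n => net.Y n ω)
          (measurable_prodMk_right (y := minScore net.marked p.score ω) hQ)
      rw [h2]
      change _ = (minIn net.marked p.score C).indicator (fun ω => K fun n => net.marked n ω) ω * _
      by_cases h1 : ω ∈ minIn net.marked p.score C
      · rw [Set.indicator_of_mem h1, Set.indicator_of_mem h1]
      · rw [Set.indicator_of_notMem h1, Set.indicator_of_notMem h1, zero_mul]
  have h1 := key (fun w => eexpNeg (∑' n, {z | minScore ζ p.score w < p.score z}.indicator φ (w n)))
    (measurable_eexpNeg.comp (measurable_tsum_minScore_lt hζ p.measurable_score hφ))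
  have h2 := key (fun w => eexpNeg (∫⁻ z in {z | minScore ζ p.score w < p.score z},
      1 - eexpNeg (φ z) ∂p.intensity))
    ((measurable_eexpNeg_setLIntegral_lt p.score _).comp hS')
  exact h1.trans ((h.hasPoissonLaplace.setLIntegral_minIn p.measurable_score
    (fun z => (p.score_pos z).le) hC hφ h.ae_finite_score h.ae_injective_score hqm).trans h2.symm)

theorem powA_eq {Ω : Type*} {p : Params} {net : Network Ω} (n : ℕ) (ω : Ω) : net.powA p n ω = (p.score (net.marked n ω))⁻¹ := by
  by_cases hL : net.LoS p n ω
  · have hL' : (net.marked n ω).2.1 ≤ p.PL ‖(net.marked n ω).1‖ := hL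
    rw [powA, Params.score, if_pos hL, if_pos hL', inv_inv]
    rfl
  · have hL' : ¬ (net.marked n ω).2.1 ≤ p.PL ‖(net.marked n ω).1‖ := hL
    rw [powA, Params.score, if_neg hL, if_neg hL', inv_inv]
    rfl

/-- Inversion reverses the order of powers, so maximal power among the ABSs means minimal score, and
the comparison with the TBSs involves that minimum alone. -/
theorem serving_iff {Ω : Type*} {p : Params} {net : Network Ω}
    (n : ℕ) (ω : Ω) : net.Serving p n ω ↔
    p.score (net.marked n ω) = minScore net.marked p.score ω ∧
      ∀ k, powAt p (net.Y k ω) ≤ (minScore net.marked p.score ω)⁻¹ := by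
  have h0 : ∀ z, 0 ≤ p.score z := fun z => (p.score_pos z).le
  have h1 : (∀ k, net.powA p k ω ≤ net.powA p n ω) ↔
      p.score (net.marked n ω) = minScore net.marked p.score ω := by
    simp only [powA_eq, inv_le_inv₀ (p.score_pos _) (p.score_pos _)]
    rw [← le_minScore_iff (Z := net.marked) h0]
    exact ⟨fun h => le_antisymm h ((le_minScore_iff h0).1 le_rfl n), le_of_eq⟩
  unfold Serving
  rw [h1]
  refine and_congr_right fun h2 => ?_
  rw [powA_eq, h2]
  rfl

theorem exists_serving_eq {Ω : Type*} {p : Params} {net : Network Ω} (C : Set MarkedPoint) :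
    {ω | ∃ n, net.marked n ω ∈ C ∧ net.Serving p n ω} = minIn net.marked p.score C ∩
      {ω | ∀ k, powAt p (net.Y k ω) ≤ (minScore net.marked p.score ω)⁻¹} := by
  ext ω
  simp only [serving_iff, minIn, Set.mem_inter_iff, Set.mem_ofPred_eq]
  constructor
  · rintro ⟨n, h1, h2, h3⟩
    exact ⟨⟨n, h1, h2⟩, h3⟩
  · rintro ⟨⟨n, h1, h2⟩, h3⟩
    exact ⟨n, h1, h2, h3⟩

theorem IsModel.measurableSet_serving (h : net.IsModel p μ) (n : ℕ) :
    MeasurableSet {ω | net.Serving p n ω} := by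
  have hS := measurable_minScore h.measurable_marked p.measurable_score
  have : {ω | net.Serving p n ω} =
      {ω | p.score (net.marked n ω) = minScore net.marked p.score ω} ∩
        ⋂ k, {ω | powAt p (net.Y k ω) ≤ (minScore net.marked p.score ω)⁻¹} := by
    ext; simp [serving_iff]
  rw [this]
  exact (measurableSet_eq_fun (p.measurable_score.comp (h.measurable_marked n)) hS).inter
    (.iInter fun k => measurableSet_le ((measurable_powAt p).comp (h.hppp_Y.measurable k)) hS.inv)

theorem IsModel.measurableSet_LoS (h : net.IsModel p μ) (n : ℕ) :
    MeasurableSet {ω | net.LoS p n ω} :=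
  h.measurable_marked n p.measurableSet_LoS

theorem IsModel.measurable_R (h : net.IsModel p μ) (n : ℕ) : Measurable (net.R p n) :=
  p.measurable_slant.comp (h.hppp_X.measurable n).norm

theorem IsModel.measurable_interfL (h : net.IsModel p μ) : Measurable (net.interfL p) := by
  refine Measurable.tsum fun n => Measurable.ite
    ((h.measurableSet_LoS n).inter (h.measurableSet_serving n).compl) ?_ measurable_const
  have := h.measurable_R n
  have := h.measurable_HL n
  fun_prop

theorem IsModel.measurable_interfN (h : net.IsModel p μ) : Measurable (net.interfN p) := by
  refine Measurable.tsum fun n => Measurable.ite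
    ((h.measurableSet_LoS n).compl.inter (h.measurableSet_serving n).compl) ?_ measurable_const
  have := h.measurable_R n
  have := h.measurable_HN n
  fun_prop

theorem IsModel.measurable_RL0 (h : net.IsModel p μ) : Measurable (net.RL0 p) :=
  measurable_sInf_of_nonneg h.measurableSet_LoS h.measurable_R fun _ _ => Real.sqrt_nonneg _

theorem IsModel.measurable_RN0 (h : net.IsModel p μ) : Measurable (net.RN0 p) :=
  measurable_sInf_of_nonneg (fun n => (h.measurableSet_LoS n).compl) h.measurable_R
    fun _ _ => Real.sqrt_nonneg _

/-- On the event that the TBSs do not dominate, the serving ABSs are those of minimal score. -/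
theorem not_serving_iff {Ω : Type*} {p : Params} {net : Network Ω} {ω : Ω}
    (hω : ∀ k, powAt p (net.Y k ω) ≤ (minScore net.marked p.score ω)⁻¹) (n : ℕ) :
    ¬ net.Serving p n ω ↔ minScore net.marked p.score ω < p.score (net.marked n ω) := by
  have hle := (le_minScore_iff (Z := net.marked) fun z => (p.score_pos z).le).1
    (le_refl (minScore net.marked p.score ω)) n
  rw [serving_iff, lt_iff_le_and_ne]
  constructor
  · exact fun h => ⟨hle, fun heq => h ⟨heq.symm, hω⟩⟩
  · exact fun h h' => h.2 h'.1.symm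

/-- When no TBS dominates, discarding the serving ABS means keeping the scores strictly above the
minimum. The weight `0` removes the NLoS links, so the sum may run over both classes. -/
theorem mul_interfL {Ω : Type*} {p : Params} {net : Network Ω} {ω : Ω}
    (hω : ∀ k, powAt p (net.Y k ω) ≤ (minScore net.marked p.score ω)⁻¹) {s : ℝ} (hs : 0 ≤ s) :
    ENNReal.ofReal s * net.interfL p ω =
      ∑' n, {z | minScore net.marked p.score ω < p.score z}.indicator (p.weighted s 0)
        (net.marked n ω) := by
  rw [interfL, ← ENNReal.tsum_mul_left]
  refine tsum_congr fun n => ?_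
  simp only [Set.indicator_apply, Set.mem_ofPred_eq, Params.weighted]
  by_cases h1 : minScore net.marked p.score ω < p.score (net.marked n ω)
  · by_cases h2 : net.LoS p n ω
    · have h2' : (net.marked n ω).2.1 ≤ p.PL ‖(net.marked n ω).1‖ := h2
      rw [if_pos ⟨h2, (not_serving_iff hω n).2 h1⟩, if_pos h1, if_pos h2', ← ENNReal.ofReal_mul hs, mul_assoc s]
      rfl
    · have h2' : ¬ (net.marked n ω).2.1 ≤ p.PL ‖(net.marked n ω).1‖ := h2
      rw [if_neg (fun h => h2 h.1), if_pos h1, if_neg h2']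
      simp
  · rw [if_neg (fun h => h1 ((not_serving_iff hω n).1 h.2)), if_neg h1, mul_zero]

theorem mul_interfN {Ω : Type*} {p : Params} {net : Network Ω} {ω : Ω}
    (hω : ∀ k, powAt p (net.Y k ω) ≤ (minScore net.marked p.score ω)⁻¹) {s : ℝ} (hs : 0 ≤ s) :
    ENNReal.ofReal s * net.interfN p ω =
      ∑' n, {z | minScore net.marked p.score ω < p.score z}.indicator (p.weighted 0 s)
        (net.marked n ω) := by
  rw [interfN, ← ENNReal.tsum_mul_left]
  refine tsum_congr fun n => ?_
  simp only [Set.indicator_apply, Set.mem_ofPred_eq, Params.weighted]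
  by_cases h1 : minScore net.marked p.score ω < p.score (net.marked n ω)
  · by_cases h2 : net.LoS p n ω
    · have h2' : (net.marked n ω).2.1 ≤ p.PL ‖(net.marked n ω).1‖ := h2
      rw [if_neg (fun h => h.1 h2), if_pos h1, if_pos h2']
      simp
    · have h2' : ¬ (net.marked n ω).2.1 ≤ p.PL ‖(net.marked n ω).1‖ := h2
      rw [if_pos ⟨h2, (not_serving_iff hω n).2 h1⟩, if_pos h1, if_neg h2', ← ENNReal.ofReal_mul hs, mul_assoc s]
      rfl
  · rw [if_neg (fun h => h1 ((not_serving_iff hω n).1 h.2)), if_neg h1, mul_zero]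

theorem mul_interfA {Ω : Type*} {p : Params} {net : Network Ω} {ω : Ω}
    (hω : ∀ k, powAt p (net.Y k ω) ≤ (minScore net.marked p.score ω)⁻¹) {s : ℝ} (hs : 0 ≤ s) :
    ENNReal.ofReal s * net.interfA p ω =
      ∑' n, {z | minScore net.marked p.score ω < p.score z}.indicator (p.weighted s s)
        (net.marked n ω) := by
  rw [interfA, mul_add, mul_interfL hω hs, mul_interfN hω hs, ← ENNReal.tsum_add]
  refine tsum_congr fun n => ?_
  simp only [Set.indicator_apply, Set.mem_ofPred_eq, Params.weighted]
  split_ifs <;> simp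

/-- All that matters about `T` is that it is a measurable event of the TBS configuration. -/
theorem measurable_tbs_event {Ω : Type*} {p : Params} {net : Network Ω} {T : Set Ω} (hT : T = Set.univ ∨ T = net.tbsInBall p ∨
    T = (net.tbsInBall p)ᶜ) :
    ∃ T' : Set (ℕ → Plane), MeasurableSet T' ∧ T = {ω | (fun n => net.Y n ω) ∈ T'} := by
  have hm : MeasurableSet {y : ℕ → Plane | ∃ k, ‖y k‖ ≤ p.RB} := by
    have : {y : ℕ → Plane | ∃ k, ‖y k‖ ≤ p.RB} = ⋃ k, {y | ‖y k‖ ≤ p.RB} := by ext; simp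
    rw [this]
    exact .iUnion fun k => measurableSet_le (by fun_prop) measurable_const
  rcases hT with rfl | rfl | rfl
  · exact ⟨Set.univ, .univ, by simp⟩
  · exact ⟨_, hm, rfl⟩
  · exact ⟨_, hm.compl, rfl⟩

/-- The conditional Laplace transform of the weighted interference, given that the serving ABS is
of class `C` and given its distance `R`, a function `ρ` of the minimal score. -/
theorem condLaplace_class [IsProbabilityMeasure μ] (h : net.IsModel p μ) {C : Set MarkedPoint}
    (hC : MeasurableSet C) {T : Set Ω}
    (hT : T = Set.univ ∨ T = net.tbsInBall p ∨ T = (net.tbsInBall p)ᶜ)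
    {R : Ω → ℝ} (hR : Measurable R) {ρ : ℝ → ℝ} (hρ : Measurable ρ)
    (hRρ : ∀ ω ∈ minIn net.marked p.score C, R ω = ρ (minScore net.marked p.score ω))
    {wL wN : ℝ → ℝ} (hwL : Measurable wL) (hwN : Measurable wN)
    (hL : ∀ ω ∈ minIn net.marked p.score C, wL (R ω) =
      p.horiz ((p.etaL * minScore net.marked p.score ω) ^ (1 / p.alphaL)))
    (hN : ∀ ω ∈ minIn net.marked p.score C, wN (R ω) =
      p.horiz ((p.etaN * minScore net.marked p.score ω) ^ (1 / p.alphaN)))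
    {s sL sN : ℝ} (hsL : 0 ≤ sL) (hsN : 0 ≤ sN) {I : Ω → ℝ≥0∞} (hI : Measurable I)
    (hIw : ∀ ω, (∀ k, powAt p (net.Y k ω) ≤ (minScore net.marked p.score ω)⁻¹) →
      ENNReal.ofReal s * I ω =
        ∑' n, {z | minScore net.marked p.score ω < p.score z}.indicator (p.weighted sL sN)
          (net.marked n ω)) :
    condLaplace μ ({ω | ∃ n, net.marked n ω ∈ C ∧ net.Serving p n ω} ∩ T) R I s
      =ᵐ[ProbabilityTheory.cond μ ({ω | ∃ n, net.marked n ω ∈ C ∧ net.Serving p n ω} ∩ T)]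
        fun ω => p.factorL sL (wL (R ω)) * p.factorN sN (wN (R ω)) := by
  obtain ⟨T', hT', rfl⟩ := measurable_tbs_event hT
  have hY : Measurable fun ω n => net.Y n ω := measurable_pi_iff.2 h.hppp_Y.measurable
  have hS := measurable_minScore h.measurable_marked p.measurable_score
  have hE := measurableSet_minIn h.measurable_marked p.measurable_score hC
  have hD := measurableSet_dominated p hT'
  have hev : {ω | ∃ n, net.marked n ω ∈ C ∧ net.Serving p n ω} ∩ {ω | (fun n => net.Y n ω) ∈ T'} =
      minIn net.marked p.score C ∩
        {ω | ((fun n => net.Y n ω), minScore net.marked p.score ω) ∈ dominated p T'} := by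
    rw [exists_serving_eq]
    ext ω
    simp only [Set.mem_inter_iff, Set.mem_ofPred_eq, dominated]
    tauto
  rw [hev]
  refine condLaplace_ae_eq (B := minIn net.marked p.score C ∩
    {ω | ((fun n => net.Y n ω), minScore net.marked p.score ω) ∈ dominated p T'}) hR hI
    (g := fun r => p.factorL sL (wL r) * p.factorN sN (wN r))
    (((p.measurable_factorL sL).comp hwL).mul ((p.measurable_factorN sN).comp hwN))
    (fun r => mul_nonneg (expNeg_nonneg _) (expNeg_nonneg _))
    (fun r => mul_le_one₀ (expNeg_le_one _) (expNeg_nonneg _) (expNeg_le_one _)) fun A hA => ?_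
  -- On the class event `R` equals `ρ` of the minimal score, so `R ∈ A` can be absorbed into the set
  -- `Q` of TBS configurations and minimal scores.
  have hA' : minIn net.marked p.score C ∩
        {ω | ((fun n => net.Y n ω), minScore net.marked p.score ω) ∈ dominated p T'} ∩ R ⁻¹' A =
      minIn net.marked p.score C ∩ {ω | ((fun n => net.Y n ω), minScore net.marked p.score ω) ∈
        dominated p T' ∩ {q | ρ q.2 ∈ A}} := by
    ext ω
    constructor
    · rintro ⟨⟨h1, h2⟩, h3⟩
      refine ⟨h1, h2, ?_⟩
      have h4 : R ω ∈ A := h3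
      rwa [hRρ ω h1] at h4
    · rintro ⟨h1, h2, h3⟩
      refine ⟨⟨h1, h2⟩, ?_⟩
      rw [Set.mem_preimage, hRρ ω h1]
      exact h3
  have hQ : MeasurableSet (dominated p T' ∩ {q | ρ q.2 ∈ A}) :=
    hD.inter ((hρ.comp measurable_snd) hA)
  rw [hA']
  have hQm := hE.inter ((hY.prodMk hS) hQ)
  refine Eq.trans (setLIntegral_congr_fun hQm fun ω hω => ?_) ((setLIntegral_minIn_dominated h hC
    (p.measurable_weighted sL sN) hQ).trans (setLIntegral_congr_fun hQm fun ω hω => ?_))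
  · exact congrArg eexpNeg (hIw ω hω.2.1.2)
  · have hS0 : 0 ≤ minScore net.marked p.score ω :=
      (le_minScore_iff fun z => (p.score_pos z).le).2 fun n => (p.score_pos _).le
    rw [p.eexpNeg_intensity hsL hsN hS0, hL ω hω.1, hN ω hω.1]

/-! ### The two association classes. -/

/-- The LoS marked points. -/
def losSet (p : Params) : Set MarkedPoint := {z | z.2.1 ≤ p.PL ‖z.1‖}

theorem score_of_mem {z : MarkedPoint} (hz : z ∈ losSet p) :
    p.score z = (p.etaL * p.slant ‖z.1‖ ^ (-p.alphaL))⁻¹ := if_pos hz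

theorem score_of_notMem {z : MarkedPoint} (hz : z ∉ losSet p) :
    p.score z = (p.etaN * p.slant ‖z.1‖ ^ (-p.alphaN))⁻¹ := if_neg hz

/-- If the minimal score is attained in a class whose scores are `(η R ^ (-α))⁻¹`, then the nearest
point of this class attains it. -/
theorem sInf_slant_eq {Ω : Type*} {p : Params} {net : Network Ω} {C : Set MarkedPoint} {eta alpha : ℝ} (he : 0 < eta) (ha : 0 < alpha)
    (hC : ∀ z ∈ C, p.score z = (eta * p.slant ‖z.1‖ ^ (-alpha))⁻¹) {ω : Ω}
    (hω : ω ∈ minIn net.marked p.score C) :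
    0 < sInf {r | ∃ n, net.marked n ω ∈ C ∧ r = net.R p n ω} ∧
    sInf {r | ∃ n, net.marked n ω ∈ C ∧ r = net.R p n ω} =
      (eta * minScore net.marked p.score ω) ^ (1 / alpha) ∧
    minScore net.marked p.score ω =
      (eta * (sInf {r | ∃ n, net.marked n ω ∈ C ∧ r = net.R p n ω}) ^ (-alpha))⁻¹ := by
  obtain ⟨n, hn, hnS⟩ := hω
  have hR : ∀ m, net.marked m ω ∈ C →
      net.R p m ω = (eta * p.score (net.marked m ω)) ^ (1 / alpha) := fun m hm =>
    (p.horiz_eq_of_score he ha (norm_nonneg _) (hC _ hm)).1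
  have hmin : ∀ m, p.score (net.marked n ω) ≤ p.score (net.marked m ω) := fun m =>
    hnS.le.trans ((le_minScore_iff fun z => (p.score_pos z).le).1 le_rfl m)
  have hinf : sInf {r | ∃ n, net.marked n ω ∈ C ∧ r = net.R p n ω} = net.R p n ω := by
    refine IsLeast.csInf_eq ⟨⟨n, hn, rfl⟩, ?_⟩
    rintro _ ⟨m, hm, rfl⟩
    rw [hR n hn, hR m hm]
    have := p.score_pos (net.marked n ω)
    exact Real.rpow_le_rpow (by positivity) (mul_le_mul_of_nonneg_left (hmin m) he.le)
      (one_div_pos.2 ha).le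
  rw [hinf, ← hnS]
  exact ⟨p.slant_pos _, hR n hn, hC _ hn⟩

theorem measurableSet_losSet (p : Params) : MeasurableSet (losSet p) := p.measurableSet_LoS

/-- The class is the complement of `losSet`. By `sInf_slant_eq`, `RN0` inverts the minimal score:
the own-class threshold is then `RN0` itself, and `rpow_threshold` turns the LoS threshold into
`tauLN`. -/
theorem IsModel.condLaplace_eventN [IsProbabilityMeasure μ] (h : net.IsModel p μ) {T : Set Ω}
    (hT : T = Set.univ ∨ T = net.tbsInBall p ∨ T = (net.tbsInBall p)ᶜ) {s sL sN : ℝ}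
    (hsL : 0 ≤ sL) (hsN : 0 ≤ sN) {I : Ω → ℝ≥0∞} (hI : Measurable I)
    (hIw : ∀ ω, (∀ k, powAt p (net.Y k ω) ≤ (minScore net.marked p.score ω)⁻¹) →
      ENNReal.ofReal s * I ω =
        ∑' n, {z | minScore net.marked p.score ω < p.score z}.indicator (p.weighted sL sN)
          (net.marked n ω)) :
    condLaplace μ (net.eventN p ∩ T) (net.RN0 p) I s =ᵐ[cond μ (net.eventN p ∩ T)]
      fun ω => p.factorL sL (p.horiz (p.tauLN (net.RN0 p ω))) *
        p.factorN sN (p.horiz (net.RN0 p ω)) := by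
  have hinf := fun ω (hω : ω ∈ minIn net.marked p.score (losSet p)ᶜ) =>
    sInf_slant_eq p.etaN_pos p.alphaN_pos (fun z hz => score_of_notMem hz) hω
  refine condLaplace_class (wL := fun r => p.horiz (p.tauLN r)) (wN := p.horiz)
    (ρ := fun v => (p.etaN * v) ^ (1 / p.alphaN)) h (measurableSet_losSet p).compl hT
    h.measurable_RN0 (by fun_prop) (fun ω hω => (hinf ω hω).2.1)
    (p.measurable_horiz.comp p.measurable_tauLN) p.measurable_horiz (fun ω hω => ?_)
    (fun ω hω => by rw [← (hinf ω hω).2.1]; rfl) hsL hsN hI hIw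
  obtain ⟨h1, -, h3⟩ := hinf ω hω
  rw [h3, Params.rpow_threshold p.etaN_pos p.etaL_pos h1]
  rfl

theorem IsModel.condLaplace_eventL [IsProbabilityMeasure μ] (h : net.IsModel p μ) {T : Set Ω}
    (hT : T = Set.univ ∨ T = net.tbsInBall p ∨ T = (net.tbsInBall p)ᶜ) {s sL sN : ℝ}
    (hsL : 0 ≤ sL) (hsN : 0 ≤ sN) {I : Ω → ℝ≥0∞} (hI : Measurable I)
    (hIw : ∀ ω, (∀ k, powAt p (net.Y k ω) ≤ (minScore net.marked p.score ω)⁻¹) →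
      ENNReal.ofReal s * I ω =
        ∑' n, {z | minScore net.marked p.score ω < p.score z}.indicator (p.weighted sL sN)
          (net.marked n ω)) :
    condLaplace μ (net.eventL p ∩ T) (net.RL0 p) I s =ᵐ[cond μ (net.eventL p ∩ T)]
      fun ω => p.factorL sL (p.horiz (net.RL0 p ω)) *
        p.factorN sN (p.horiz (p.tauNL (net.RL0 p ω))) := by
  have hinf := fun ω (hω : ω ∈ minIn net.marked p.score (losSet p)) =>
    sInf_slant_eq p.etaL_pos p.alphaL_pos (fun z hz => score_of_mem hz) hω
  refine condLaplace_class (wL := p.horiz) (wN := fun r => p.horiz (p.tauNL r))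
    (ρ := fun v => (p.etaL * v) ^ (1 / p.alphaL)) h (measurableSet_losSet p) hT
    h.measurable_RL0 (by fun_prop) (fun ω hω => (hinf ω hω).2.1) p.measurable_horiz
    (p.measurable_horiz.comp p.measurable_tauNL)
    (fun ω hω => by rw [← (hinf ω hω).2.1]; rfl) (fun ω hω => ?_) hsL hsN hI hIw
  obtain ⟨h1, -, h3⟩ := hinf ω hω
  rw [h3, Params.rpow_threshold p.etaL_pos p.etaN_pos h1, p.horiz_tauNL h1]
  rfl

end Network
end UAVNet

theorem mainTheorem4 {Ω : Type*} [MeasurableSpace Ω] (μ : MeasureTheory.Measure Ω)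
    [MeasureTheory.IsProbabilityMeasure μ] (p : UAVNet.Params) (net : UAVNet.Network Ω)
    (hnet : net.IsModel p μ) (s : ℝ) (hs : 0 ≤ s)
    (T : Set Ω) (hT : T = Set.univ ∨ T = net.tbsInBall p ∨ T = (net.tbsInBall p)ᶜ) :
    -- the UE is served by a NLoS ABS at distance `r = RN0`
    (UAVNet.condLaplace μ (net.eventN p ∩ T) (net.RN0 p) (net.interfA p) s
        =ᵐ[ProbabilityTheory.cond μ (net.eventN p ∩ T)]
          fun ω => p.factorL s (p.horiz (p.tauLN (net.RN0 p ω))) *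
            p.factorN s (p.horiz (net.RN0 p ω))) ∧
    (UAVNet.condLaplace μ (net.eventN p ∩ T) (net.RN0 p) (net.interfL p) s
        =ᵐ[ProbabilityTheory.cond μ (net.eventN p ∩ T)]
          fun ω => p.factorL s (p.horiz (p.tauLN (net.RN0 p ω)))) ∧
    (UAVNet.condLaplace μ (net.eventN p ∩ T) (net.RN0 p) (net.interfN p) s
        =ᵐ[ProbabilityTheory.cond μ (net.eventN p ∩ T)]
          fun ω => p.factorN s (p.horiz (net.RN0 p ω))) ∧
    -- the UE is served by a LoS ABS at distance `r = RL0`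
    (UAVNet.condLaplace μ (net.eventL p ∩ T) (net.RL0 p) (net.interfA p) s
        =ᵐ[ProbabilityTheory.cond μ (net.eventL p ∩ T)]
          fun ω => p.factorL s (p.horiz (net.RL0 p ω)) *
            p.factorN s (p.horiz (p.tauNL (net.RL0 p ω)))) ∧
    (UAVNet.condLaplace μ (net.eventL p ∩ T) (net.RL0 p) (net.interfL p) s
        =ᵐ[ProbabilityTheory.cond μ (net.eventL p ∩ T)]
          fun ω => p.factorL s (p.horiz (net.RL0 p ω))) ∧
    (UAVNet.condLaplace μ (net.eventL p ∩ T) (net.RL0 p) (net.interfN p) s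
        =ᵐ[ProbabilityTheory.cond μ (net.eventL p ∩ T)]
          fun ω => p.factorN s (p.horiz (p.tauNL (net.RL0 p ω)))) := by
  have hA : Measurable (net.interfA p) := hnet.measurable_interfL.add hnet.measurable_interfN
  refine ⟨hnet.condLaplace_eventN hT hs hs hA fun _ hω => UAVNet.Network.mul_interfA hω hs, ?_, ?_,
    hnet.condLaplace_eventL hT hs hs hA fun _ hω => UAVNet.Network.mul_interfA hω hs, ?_, ?_⟩
  -- For a single tier, the weight of the other one is set to `0`, which makes its factor `1`.
  · simpa only [UAVNet.Params.factorN_zero, mul_one] using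
      hnet.condLaplace_eventN hT hs le_rfl hnet.measurable_interfL
        fun _ hω => UAVNet.Network.mul_interfL hω hs
  · simpa only [UAVNet.Params.factorL_zero, one_mul] using
      hnet.condLaplace_eventN hT le_rfl hs hnet.measurable_interfN
        fun _ hω => UAVNet.Network.mul_interfN hω hs
  · simpa only [UAVNet.Params.factorN_zero, mul_one] using
      hnet.condLaplace_eventL hT hs le_rfl hnet.measurable_interfL
        fun _ hω => UAVNet.Network.mul_interfL hω hs
  · simpa only [UAVNet.Params.factorL_zero, one_mul] using
      hnet.condLaplace_eventL hT le_rfl hs hnet.measurable_interfN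
        fun _ hω => UAVNet.Network.mul_interfN hω hs
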